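/- **Setting.** Let $n$ be a number of qubits, let $\sigma^0=I$ and let $\sigma^1,\sigma^2,\sigma^3$ be the Pauli matrices $X,Y,Z$; for $\mathbf a\in\{0,1,2,3\}^n$ put $\sigma^{\mathbf a}=\sigma^{a_1}\otimes\cdots\otimes\sigma^{a_n}$, and write $\sigma^a_j$ for $\sigma^a$ acting on qubit $j$ only. For $\boldsymbol\mu=(\mu_{\mathbf a})_{\mathbf a\ne\mathbf 0}\in\mathbb R^{4^n-1}$ and $\nu\in\mathbb R$, and for $k\in\{1,\dots,n\}$, $\mathbf s\in\{0,1\}^n$, $\boldsymbol\beta\in\{1,2,3\}^n$, let $$H_{\mathrm{tot}}(\boldsymbol\mu,\nu,k,\mathbf s,\boldsymbol\beta)=\sum_{\mathbf a\neq\mathbf 0}\mu_{\mathbf a}\sigma^{\mathbf a}-\nu\Big(\sum_{j\ne k}(-1)^{s_j}\sigma^{\beta_j}_j+\tfrac12(-1)^{s_k}\sigma^{\beta_k}_k\Big),$$ and let $E_\Delta(\boldsymbol\mu,\nu,k,\mathbf s,\boldsymbol\beta)=E_1-E_0$ be the difference of its two lowest eigenvalues, counted with multiplicity. Let $\mathbf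 E(\boldsymbol\mu,\nu)\in\mathbb R^{6^n n}$ be the vector of these gaps over all $(k,\mathbf s,\boldsymbol\beta)$, and let $L(\hat{\mathbf E},\boldsymbol\mu,\nu)=\tfrac12\|\hat{\mathbf E}-\mathbf E(\boldsymbol\mu,\nu)\|^2$. All norms are Euclidean, and $B_\rho(x)$ is the open ball of radius $\rho$ around $x$. **Computation model.** An oracle program is a program in a while-language over real registers, with rational constants, exact arithmetic operations, comparisons, and calls to an oracle that returns the value $\mathbf E(\boldsymbol\mu,\nu)$ (and no derivative) at any $\boldsymbol\mu$ that the program has computed. Its inputs are $\hat{\mathbf E}$, an initial guess $\boldsymbol\lambda^0$ and the precision $\epsilon_1$; neither $\boldsymbol\lambda$ nor $\nu$ is an input. **Theorem S2.** For every $n$ there are constants $\nu_0,r,r_\lambda>0$ and $C,K\in\mathbb R$ and an oracle program $P$, all depending only on $n$, such that the following holds for every $\nu\ge\nu_0$ and every $\boldsymbol\lambda\in[-1,1]^{4^n-1}$. Put $\mathbf E^\star=\mathbf E(\boldsymbol\lambda,\nu)$. There is a $C^\infty$ map $g:B_r(\mathbf E^\star)\to\mathbb R^{4^n-1}$ such that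 for all $\hat{\mathbf E}\in B_r(\mathbf E^\star)$: 1. $\|g(\hat{\mathbf E})-\boldsymbol\lambda\|\le C\,\|\hat{\mathbf E}-\mathbf E^\star\|$; 2. $g(\hat{\mathbf E})$ is the solution near $\boldsymbol\lambda$ of the least-squares problem: it lies in $B_{r_\lambda}(\boldsymbol\lambda)$, it is the only point $\boldsymbol\mu$ of that ball with $\nabla_{\boldsymbol\mu}L(\hat{\mathbf E},\boldsymbol\mu,\nu)=0$, and it is the unique minimizer of $L(\hat{\mathbf E},\cdot,\nu)$ on that ball; 3. for every initial guess $\boldsymbol\lambda^0$ with $\|\boldsymbol\lambda^0-\boldsymbol\lambda\|<r_\lambda$ and every $0<\epsilon_1\le\frac12$, the program $P$ on input $(\hat{\mathbf E},\boldsymbol\lambda^0,\epsilon_1)$ halts with an output $\mathbf y$ satisfying $\|\mathbf y-g(\hat{\mathbf E})\|\le\epsilon_1$, after at most $K\log(1/\epsilon_1)$ evaluations of $\mathbf E(\cdot,\nu)$ and at most $K\log(1/\epsilon_1)$ further steps (assignments, arithmetic operations and comparisons). -/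

import Mathlib

open scoped ContDiff

noncomputable section

namespace HamLearn

/-! ### Pauli operators on `n` qubits -/

/-- The single-qubit matrices `σ⁰ = 1`, `σ¹ = X`, `σ² = Y`, `σ³ = Z`. -/
def pauli : Fin 4 → Matrix (Fin 2) (Fin 2) ℂ
  | 0 => !![1, 0; 0, 1]
  | 1 => !![0, 1; 1, 0]
  | 2 => !![0, -Complex.I; Complex.I, 0]
  | 3 => !![1, 0; 0, -1]

/-- Computational basis of `(ℂ²)^{⊗ n}`. -/
abbrev Basis (n : ℕ) : Type := Fin n → Fin 2

/-- The tensor product `σ^{a₁} ⊗ ⋯ ⊗ σ^{aₙ}`, written out in the computational basis. -/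
def pauliString {n : ℕ} (a : Fin n → Fin 4) : Matrix (Basis n) (Basis n) ℂ :=
  fun x y => ∏ j, pauli (a j) (x j) (y j)

/-- The operator `σ^b` acting on qubit `j` only. -/
def pauliAt {n : ℕ} (j : Fin n) (b : Fin 4) : Matrix (Basis n) (Basis n) ℂ :=
  pauliString (Pi.single j b)

/-- Labels of the coefficients: nonzero strings in `{0,1,2,3}ⁿ`; there are `4ⁿ - 1` of them. -/
abbrev Label (n : ℕ) : Type := {a : Fin n → Fin 4 // a ≠ 0}

/-- Labels `(k, s, β)` of the experiments; there are `n · 2ⁿ · 3ⁿ` of them.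
The direction `β_j ∈ {1,2,3}` is `Fin.succ` of the entry in `Fin 3`. -/
abbrev Expt (n : ℕ) : Type := Fin n × (Fin n → Fin 2) × (Fin n → Fin 3)

/-- Coefficient vectors, with the Euclidean norm. -/
abbrev Coeffs (n : ℕ) : Type := EuclideanSpace ℝ (Label n)

/-- Vectors of energy gaps, with the Euclidean norm. -/
abbrev Gaps (n : ℕ) : Type := EuclideanSpace ℝ (Expt n)

/-! ### The Hamiltonians -/

/-- `H(μ) = ∑_{a ≠ 0} μ_a σ^a`. -/
def ham {n : ℕ} (μ : Coeffs n) : Matrix (Basis n) (Basis n) ℂ :=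
  ∑ a : Label n, ((μ a : ℝ) : ℂ) • pauliString a.1

/-- `H_ctrl(k,s,β) = ∑_{j ≠ k} (-1)^{s_j} σ^{β_j}_j + (1/2) (-1)^{s_k} σ^{β_k}_k`. -/
def hamCtrl {n : ℕ} (e : Expt n) : Matrix (Basis n) (Basis n) ℂ :=
  ∑ j : Fin n, ((if j = e.1 then (1 / 2 : ℂ) else 1) * (-1 : ℂ) ^ (e.2.1 j : ℕ)) •
    pauliAt j (e.2.2 j).succ

/-- `H_tot(μ,ν,k,s,β) = H(μ) - ν H_ctrl(k,s,β)`. -/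
def hamTot {n : ℕ} (μ : Coeffs n) (ν : ℝ) (e : Expt n) : Matrix (Basis n) (Basis n) ℂ :=
  ham μ - (ν : ℂ) • hamCtrl e

theorem pauli_isHermitian (a : Fin 4) : (pauli a).IsHermitian := by
  ext i j
  fin_cases a <;> fin_cases i <;> fin_cases j <;> simp [pauli, Matrix.conjTranspose_apply]

theorem pauliString_isHermitian {n : ℕ} (a : Fin n → Fin 4) :
    (pauliString a).IsHermitian := by
  ext x y
  simp only [Matrix.conjTranspose_apply, pauliString, star_prod]
  exact Finset.prod_congr rfl fun j _ => (pauli_isHermitian (a j)).apply (x j) (y j)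

theorem ham_isHermitian {n : ℕ} (μ : Coeffs n) : (ham μ).IsHermitian := by
  unfold ham Matrix.IsHermitian
  rw [Matrix.conjTranspose_sum]
  refine Finset.sum_congr rfl fun a _ => ?_
  rw [Matrix.conjTranspose_smul, (pauliString_isHermitian a.1).eq]
  simp

theorem hamCtrl_isHermitian {n : ℕ} (e : Expt n) : (hamCtrl e).IsHermitian := by
  unfold hamCtrl Matrix.IsHermitian
  rw [Matrix.conjTranspose_sum]
  refine Finset.sum_congr rfl fun j _ => ?_
  rw [Matrix.conjTranspose_smul, pauliAt, (pauliString_isHermitian _).eq]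
  congr 1
  split_ifs <;> simp

theorem hamTot_isHermitian {n : ℕ} (μ : Coeffs n) (ν : ℝ) (e : Expt n) :
    (hamTot μ ν e).IsHermitian := by
  unfold hamTot
  refine (ham_isHermitian μ).sub ?_
  unfold Matrix.IsHermitian
  rw [Matrix.conjTranspose_smul, (hamCtrl_isHermitian e).eq]
  simp

/-! ### Energy gaps -/

/-- The `i`-th lowest eigenvalue (`i = 0, 1, …`, counted with multiplicity) of a Hermitian matrix.
Mathlib's `eigenvalues₀` lists the eigenvalues in decreasing order. -/
def energy {m : Type} [Fintype m] [DecidableEq m] {A : Matrix m m ℂ} (hA : A.IsHermitian)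
    (i : ℕ) (hi : i < Fintype.card m) : ℝ :=
  hA.eigenvalues₀ (Fin.rev ⟨i, hi⟩)

theorem one_lt_card_basis {n : ℕ} (k : Fin n) : 1 < Fintype.card (Basis n) := by
  have hn : n ≠ 0 := by
    have := k.2
    omega
  simpa using Nat.one_lt_two_pow hn

/-- The gap `E_Δ(μ,ν,k,s,β) = E₁ - E₀` between the first excited and the ground energy
of `H_tot(μ,ν,k,s,β)`. -/
def energyGap {n : ℕ} (μ : Coeffs n) (ν : ℝ) (e : Expt n) : ℝ :=
  energy (hamTot_isHermitian μ ν e) 1 (one_lt_card_basis e.1) -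
    energy (hamTot_isHermitian μ ν e) 0 (zero_lt_one.trans (one_lt_card_basis e.1))

/-- The vector `E(μ,ν)` of all energy gaps. -/
def gapVec {n : ℕ} (ν : ℝ) (μ : Coeffs n) : Gaps n :=
  WithLp.toLp 2 fun e => energyGap μ ν e

/-- The least-squares loss `L(Ê,μ,ν) = ½ ‖Ê - E(μ,ν)‖²`. -/
def loss {n : ℕ} (ν : ℝ) (Ehat : Gaps n) (μ : Coeffs n) : ℝ :=
  (1 / 2) * ‖Ehat - gapVec ν μ‖ ^ 2

/-! ### Oracle programs

A while-language over real registers, with exact rational arithmetic operations, comparisons, and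
calls to an oracle for a map from coefficient vectors to gap vectors. The constants in a program
are rational numbers, so a program is a finite object. -/

/-- Registers of a program. -/
inductive Reg (n : ℕ) : Type
  /-- input: the coordinates of `Ê` -/
  | est (e : Expt n)
  /-- input: the tolerance -/
  | tol
  /-- input: the initial guess; read as the output at the end -/
  | cur (a : Label n)
  /-- the argument of the oracle -/
  | arg (a : Label n)
  /-- the answer of the oracle -/
  | ans (e : Expt n)
  /-- work registers -/
  | tmp (i : ℕ)
deriving DecidableEq

/-- Contents of the registers. -/
abbrev Store (n : ℕ) : Type := Reg n → ℝ

/-- The arithmetic operations. -/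
inductive Op : Type
  | add
  | sub
  | mul
  | div

/-- Value of an arithmetic operation. -/
def Op.eval : Op → ℝ → ℝ → ℝ
  | .add, x, y => x + y
  | .sub, x, y => x - y
  | .mul, x, y => x * y
  | .div, x, y => x / y

/-- Programs. -/
inductive Prog (n : ℕ) : Type
  | skip
  /-- `x := q` -/
  | const (x : Reg n) (q : ℚ)
  /-- `x := y ∘ z` for an arithmetic operation `∘` -/
  | arith (o : Op) (x y z : Reg n)
  /-- `ans := O(arg)` for the oracle `O` -/
  | query
  | seq (c d : Prog n)
  /-- `if x < y then c else d` -/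
  | ite (x y : Reg n) (c d : Prog n)
  /-- `while x < y do c` -/
  | while (x y : Reg n) (c : Prog n)

/-- The store after a call of the oracle. -/
def Store.query {n : ℕ} (O : Coeffs n → Gaps n) (σ : Store n) : Store n
  | .ans e => O (WithLp.toLp 2 fun a => σ (.arg a)) e
  | x => σ x

/-- `Exec O c σ σ' q t`: with oracle `O`, the program `c` started on the store `σ` halts with the
store `σ'` after `q` oracle calls and `t` further steps (assignments, arithmetic operations and
comparisons). -/
inductive Exec {n : ℕ} (O : Coeffs n → Gaps n) :
    Prog n → Store n → Store n → ℕ → ℕ → Prop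
  | skip (σ) : Exec O .skip σ σ 0 0
  | const (σ x q) : Exec O (.const x q) σ (Function.update σ x (q : ℝ)) 0 1
  | arith (σ o x y z) :
      Exec O (.arith o x y z) σ (Function.update σ x (o.eval (σ y) (σ z))) 0 1
  | query (σ) : Exec O .query σ (σ.query O) 1 0
  | seq {c d σ₁ σ₂ σ₃ q₁ q₂ t₁ t₂} (h₁ : Exec O c σ₁ σ₂ q₁ t₁) (h₂ : Exec O d σ₂ σ₃ q₂ t₂) :
      Exec O (.seq c d) σ₁ σ₃ (q₁ + q₂) (t₁ + t₂)
  | ite_true {x y c d σ σ' q t} (h : σ x < σ y) (h₁ : Exec O c σ σ' q t) :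
      Exec O (.ite x y c d) σ σ' q (t + 1)
  | ite_false {x y c d σ σ' q t} (h : ¬ σ x < σ y) (h₁ : Exec O d σ σ' q t) :
      Exec O (.ite x y c d) σ σ' q (t + 1)
  | while_true {x y c σ₁ σ₂ σ₃ q₁ q₂ t₁ t₂} (h : σ₁ x < σ₁ y)
      (h₁ : Exec O c σ₁ σ₂ q₁ t₁) (h₂ : Exec O (.while x y c) σ₂ σ₃ q₂ t₂) :
      Exec O (.while x y c) σ₁ σ₃ (q₁ + q₂) (t₁ + t₂ + 1)
  | while_false {x y c σ} (h : ¬ σ x < σ y) : Exec O (.while x y c) σ σ 0 1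

/-- The store on which a program is started: all registers other than the inputs are `0`. -/
def Store.init {n : ℕ} (Ehat : Gaps n) (guess : Coeffs n) (ε : ℝ) : Store n
  | .est e => Ehat e
  | .cur a => guess a
  | .tol => ε
  | _ => 0

/-- The vector that is read off when a program has halted. -/
def Store.output {n : ℕ} (σ : Store n) : Coeffs n := WithLp.toLp 2 fun a => σ (.cur a)

end HamLearn

end

noncomputable section
namespace HamLearn

/-! ### Simple eigenvalues of a perturbed diagonal matrix -/

section Spectral

open Filter Topology

/-! Only the ratio of Hamiltonian to control field matters: `gapVec ν μ = ν • gapVec 1 (ν⁻¹ • μ)`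
(`gapVec_scale`). A strong field is thus a unit field with a small perturbation, and everything
reduces to the behaviour of `gapVec 1` near `0`.

At `0` the Hamiltonian is diagonal in a product basis. Flipping qubit `k` costs energy 1 and any
other excitation at least 2, so the two lowest levels are simple. By the implicit function theorem
applied to the characteristic polynomial they are analytic near `0`, and their derivatives are
diagonal matrix entries (`gap_of_perturbed_diagonal`). The derivative of a gap is therefore a
difference of expectation values of Pauli strings in two product states. Summing these over the
signs `s` against a character isolates each coefficient (`coeff_of_gapDeriv`), so the derivative `A`
of the gap vector is injective.

The chain rule cancels the two powers of `ν`. For large `ν` the derivative of `gapVec ν` is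
uniformly close to `A`, with a small Lipschitz constant, on a ball of radius 4 around every
admissible `lam` (`exists_nearlyLinear`). There the least-squares gradient is strongly monotone and
Lipschitz (`strong_mono`, `lipschitz_lsGrad`), so a gradient step is a contraction (`contraction`).
Its fixed point is `g`; uniqueness, minimality, stability and smoothness all follow from
monotonicity and contraction.

The program runs this descent with forward differences of step `κ ε₁` in place of derivatives. The
resulting bias is a fraction of `ε₁`, and geometric convergence gives the logarithmic cost
(`descent_exec`). Step size, difference step and rate depend only on the bounds for `A`, hence only
on `n`. -/

/-- Derivative of the determinant at a diagonal matrix with a zero on the diagonal. -/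
theorem hasFDerivAt_det_of_diagonal {m : Type*} [Fintype m] [DecidableEq m]
    {E : Type*} [NormedAddCommGroup E] [NormedSpace ℝ E]
    {B : m → m → E → ℂ} {b : m → m → E →L[ℝ] ℂ} {z : E} {i₀ : m}
    (hB : ∀ i j, HasFDerivAt (B i j) (b i j) z)
    (hoff : ∀ i j, i ≠ j → B i j z = 0) (h0 : B i₀ i₀ z = 0) :
    HasFDerivAt (fun x => (Matrix.of fun i j => B i j x).det)
      ((∏ j ∈ Finset.univ.erase i₀, B j j z) • b i₀ i₀) z := by
  have h1 : HasFDerivAt (fun x => (Matrix.of fun i j => B i j x).det)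
      (∑ τ : Equiv.Perm m, (Equiv.Perm.sign τ) •
        ∑ i, (∏ j ∈ Finset.univ.erase i, B (τ j) j z) • b (τ i) i) z := by
    simp only [Matrix.det_apply, Matrix.of_apply]
    refine HasFDerivAt.fun_sum fun τ _ => ?_
    exact (HasFDerivAt.finsetProd (u := Finset.univ) fun i _ => hB (τ i) i).const_smul _
  refine h1.congr_fderiv ?_
  rw [Finset.sum_eq_single 1]
  · rw [Finset.sum_eq_single i₀]
    · simp
    · intro i _ hi
      have h2 : ∏ j ∈ Finset.univ.erase i, B ((1 : Equiv.Perm m) j) j z = 0 :=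
        Finset.prod_eq_zero (i := i₀) (by simpa using hi.symm) (by simpa using h0)
      rw [h2]
      ext v
      exact zero_mul _
    · simp
  · intro τ _ hτ
    rw [Finset.sum_eq_zero, smul_zero]
    intro i _
    -- A nontrivial permutation moves at least two indices, so an off-diagonal factor, which
    -- vanishes at `z`, survives the removal of the factor `i`.
    suffices ∃ j, j ≠ i ∧ τ j ≠ j by
      obtain ⟨j, hj, hj'⟩ := this
      have h2 : ∏ j ∈ Finset.univ.erase i, B (τ j) j z = 0 :=
        Finset.prod_eq_zero (i := j) (by simpa using hj) (hoff _ _ hj')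
      rw [h2]
      ext v
      exact zero_mul _
    by_contra! h
    apply hτ
    ext j
    by_cases hj : j = i
    · by_contra hne
      have h2 : τ (τ i) = τ i := h _ (by subst hj; simpa using hne)
      exact hne (by subst hj; simpa using h2)
    · simpa using h j hj
  · simp

variable {m : Type} [Fintype m] [DecidableEq m]
  {E : Type*} [NormedAddCommGroup E] [NormedSpace ℝ E]

/-- The real part of the characteristic polynomial of `diag(d) + w(x)`, at `t`. -/
def charFun (d : m → ℝ) (w : m → m → E →L[ℝ] ℂ) (z : E × ℝ) : ℝ :=
  (Matrix.det (Matrix.of fun i j => (if i = j then ((z.2 - d i : ℝ) : ℂ) else 0) - w i j z.1)).re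

theorem contDiff_charFun (d : m → ℝ) (w : m → m → E →L[ℝ] ℂ) : ContDiff ℝ ω (charFun d w) := by
  have hE : ∀ i j, ContDiff ℝ ω fun z : E × ℝ =>
      (if i = j then ((z.2 - d i : ℝ) : ℂ) else 0) - w i j z.1 := by
    intro i j
    refine ContDiff.sub ?_ ((w i j).contDiff.comp contDiff_fst)
    split_ifs
    · exact Complex.ofRealCLM.contDiff.comp (contDiff_snd.sub contDiff_const)
    · exact contDiff_const
  unfold charFun
  simp only [Matrix.det_apply, Matrix.of_apply]
  refine Complex.reCLM.contDiff.comp ?_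
  exact ContDiff.sum fun τ _ => (contDiff_prod fun i _ => hE _ _).const_smul _

/-- At this point the matrix is diagonal with a zero in place `i₀`, so only the entry `i₀ i₀` is
felt to first order. This is first-order perturbation theory: the root moves with the diagonal entry
of the perturbation. -/
theorem hasFDerivAt_charFun {d : m → ℝ} (w : m → m → E →L[ℝ] ℂ) (i₀ : m) :
    HasFDerivAt (charFun d w) ((∏ j ∈ Finset.univ.erase i₀, (d i₀ - d j)) •
      (ContinuousLinearMap.snd ℝ E ℝ -
        (Complex.reCLM ∘L w i₀ i₀) ∘L ContinuousLinearMap.fst ℝ E ℝ)) (0, d i₀) := by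
  have h := hasFDerivAt_det_of_diagonal (z := ((0 : E), d i₀)) (i₀ := i₀)
    (B := fun i j z => (if i = j then ((z.2 - d i : ℝ) : ℂ) else 0) - w i j z.1)
    (b := fun i j => (if i = j then Complex.ofRealCLM ∘L ContinuousLinearMap.snd ℝ E ℝ else 0) -
      (w i j) ∘L ContinuousLinearMap.fst ℝ E ℝ) ?_ ?_ ?_
  · have h' := Complex.reCLM.hasFDerivAt.comp _ h
    have hc : ∏ j ∈ Finset.univ.erase i₀, ((d i₀ - d j : ℝ) : ℂ) =
        ((∏ j ∈ Finset.univ.erase i₀, (d i₀ - d j) : ℝ) : ℂ) := (Complex.ofReal_prod _ _).symm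
    refine h'.congr_fderiv ?_
    simp only [if_true, map_zero, sub_zero, hc]
    generalize ∏ j ∈ Finset.univ.erase i₀, (d i₀ - d j) = c
    ext v
    · simp
    · simp
  · intro i j
    refine HasFDerivAt.sub ?_ ((w i j).hasFDerivAt.comp _ hasFDerivAt_fst)
    split_ifs
    · exact Complex.ofRealCLM.hasFDerivAt.comp _ (hasFDerivAt_snd.sub_const _)
    · exact hasFDerivAt_const _ _
  · intro i j hij
    simp [hij]
  · simp

/-- The root of the characteristic polynomial that starts at a simple diagonal entry. -/
theorem exists_simple_root [CompleteSpace E] {d : m → ℝ} (w : m → m → E →L[ℝ] ℂ) {i₀ : m}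
    (hd : ∀ j, j ≠ i₀ → d j ≠ d i₀) :
    ∃ φ : E → ℝ, ContDiffAt ℝ ω φ 0 ∧ φ 0 = d i₀ ∧
      HasFDerivAt φ (Complex.reCLM ∘L w i₀ i₀) 0 ∧
      (∀ᶠ z in 𝓝 ((0 : E), d i₀), charFun d w z = 0 ↔ φ z.1 = z.2) ∧
      ∀ᶠ x in 𝓝 (0 : E), fderiv ℝ (charFun d w) (x, φ x) (0, 1) ≠ 0 := by
  set p := charFun d w
  set c := ∏ j ∈ Finset.univ.erase i₀, (d i₀ - d j) with hc_def
  have hc : c ≠ 0 := Finset.prod_ne_zero_iff.2 fun j hj =>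
    sub_ne_zero.2 (hd j (Finset.ne_of_mem_erase hj)).symm
  have hp : ContDiffAt ℝ ω p (0, d i₀) := (contDiff_charFun d w).contDiffAt
  have hp' := hasFDerivAt_charFun (d := d) w i₀
  rw [← hc_def] at hp'
  have hp0 : p (0, d i₀) = 0 := by
    have h0 : Matrix.of (fun i j => (if i = j then ((d i₀ - d i : ℝ) : ℂ) else 0) - w i j (0 : E)) =
        Matrix.diagonal fun i => ((d i₀ - d i : ℝ) : ℂ) := by
      ext i j
      simp [Matrix.diagonal_apply]
    simp only [p, charFun]
    rw [h0, Matrix.det_diagonal, Finset.prod_eq_zero (Finset.mem_univ i₀) (by simp)]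
    rfl
  have hinv : (fderiv ℝ p (0, d i₀) ∘L .inr ℝ E ℝ).IsInvertible := by
    refine ⟨ContinuousLinearEquiv.unitsEquivAut ℝ (Units.mk0 c hc), ?_⟩
    rw [hp'.fderiv]
    ext
    simp
  have hφ := hp.contDiffAt_implicitFunction (by simp) hinv
  have hφ0 := hp.implicitFunction_apply_self (by simp) hinv
  have hφ' := (hp.hasStrictFDerivAt_implicitFunction (by simp) hinv).hasFDerivAt
  have hiff := hp.eventually_apply_eq_iff_implicitFunction (by simp) hinv
  rw [hp0] at hiff
  set φ := hp.implicitFunction (by simp) hinv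
  simp only at hφ hφ0 hφ'
  have hderiv : HasFDerivAt φ (Complex.reCLM ∘L w i₀ i₀) 0 := by
    refine hφ'.congr_fderiv ?_
    rw [hp'.fderiv]
    have h1 : ((c • (ContinuousLinearMap.snd ℝ E ℝ -
        (Complex.reCLM ∘L w i₀ i₀) ∘L ContinuousLinearMap.fst ℝ E ℝ)) ∘L .inr ℝ E ℝ) =
        ((ContinuousLinearEquiv.unitsEquivAut ℝ (Units.mk0 c hc) : ℝ ≃L[ℝ] ℝ) : ℝ →L[ℝ] ℝ) := by
      ext
      simp
    rw [h1, ContinuousLinearMap.inverse_equiv]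
    ext v
    simp
    field_simp
  refine ⟨φ, hφ, hφ0, hderiv, hiff, ?_⟩
  -- The derivative in `t` is `c ≠ 0` at the base point and stays nonzero nearby; this later shows
  -- that the root is a simple eigenvalue.
  have hcont : ContinuousAt (fun x => fderiv ℝ p (x, φ x) (0, 1)) 0 := by
    have h1 : Continuous fun z => fderiv ℝ p z (0, 1) :=
      ((contDiff_charFun d w).continuous_fderiv (by simp)).clm_apply continuous_const
    exact h1.continuousAt.comp (continuousAt_id.prodMk hφ.continuousAt)
  refine hcont.eventually_ne ?_
  simp only [hφ0, p, hp'.fderiv]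
  simpa using hc

/-- Roots of the characteristic polynomial stay close to the diagonal entries. -/
theorem eventually_root_near_diagonal (d : m → ℝ) (w : m → m → E →L[ℝ] ℂ) {δ : ℝ} (hδ : 0 < δ) :
    ∀ᶠ x in 𝓝 (0 : E), ∀ t : ℝ,
      Matrix.det (Matrix.of fun i j => (if i = j then ((t - d i : ℝ) : ℂ) else 0) - w i j x) = 0 →
      ∃ k, |t - d k| < δ := by
  have h1 : ∀ᶠ x in 𝓝 (0 : E), ∀ k, ∑ j, ‖w k j x‖ < δ := by
    rw [eventually_all]
    intro k
    have : Tendsto (fun x : E => ∑ j, ‖w k j x‖) (𝓝 0) (𝓝 (∑ j, ‖w k j 0‖)) :=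
      (continuous_finsetSum _ fun j _ => (w k j).continuous.norm).tendsto 0
    simp only [map_zero, norm_zero, Finset.sum_const_zero] at this
    exact this.eventually_lt_const hδ
  filter_upwards [h1] with x hx t ht
  by_contra! hk
  -- If `t` keeps distance `δ` from every diagonal entry, rows of the perturbation with norm sum
  -- below `δ` leave the matrix strictly diagonally dominant.
  refine det_ne_zero_of_sum_row_lt_diag (fun k => ?_) ht
  have h2 : ∑ j ∈ Finset.univ.erase k, ‖w k j x‖ + ‖w k k x‖ < δ := by
    rw [Finset.sum_erase_add _ _ (Finset.mem_univ k)]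
    exact hx k
  have h3 : ∀ j ∈ Finset.univ.erase k,
      ‖Matrix.of (fun i j => (if i = j then ((t - d i : ℝ) : ℂ) else 0) - w i j x) k j‖
        = ‖w k j x‖ := by
    intro j hj
    have : k ≠ j := (Finset.ne_of_mem_erase hj).symm
    simp [this]
  rw [Finset.sum_congr rfl h3]
  simp only [Matrix.of_apply, if_true]
  have h4 := norm_sub_norm_le (((t - d k : ℝ) : ℂ)) (w k k x)
  have h5 : ‖((t - d k : ℝ) : ℂ)‖ = |t - d k| := by simp only [Complex.norm_real, Real.norm_eq_abs]
  have := hk k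
  linarith

/-- The two smallest terms of a finite decreasing sequence. -/
theorem two_smallest_of_antitone {N : ℕ} (hN : 1 < N) {ev : Fin N → ℝ} (hev : Antitone ev)
    {t₀ t₁ : ℝ} (h01 : t₀ < t₁) (h0 : ∃ i, ev i = t₀) (h1 : ∃ i, ev i = t₁)
    (hle : ∀ i, ev i = t₀ ∨ t₁ ≤ ev i) (huniq : ∀ i j, ev i = t₀ → ev j = t₀ → i = j) :
    ev (Fin.rev ⟨0, zero_lt_one.trans hN⟩) = t₀ ∧ ev (Fin.rev ⟨1, hN⟩) = t₁ := by
  obtain ⟨i, hi⟩ := h0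
  obtain ⟨j, hj⟩ := h1
  have hz : ev (Fin.rev ⟨0, zero_lt_one.trans hN⟩) = t₀ := by
    have h2 : ev (Fin.rev ⟨0, zero_lt_one.trans hN⟩) ≤ ev i :=
      hev (by rw [Fin.le_def, Fin.val_rev]; simp; omega)
    rcases hle (Fin.rev ⟨0, zero_lt_one.trans hN⟩) with h | h
    · exact h
    · linarith
  refine ⟨hz, ?_⟩
  have hne : Fin.rev (⟨1, hN⟩ : Fin N) ≠ Fin.rev ⟨0, zero_lt_one.trans hN⟩ := by
    simp
  have hlow : t₁ ≤ ev (Fin.rev ⟨1, hN⟩) := by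
    rcases hle (Fin.rev ⟨1, hN⟩) with h | h
    · exact absurd (huniq _ _ h hz) hne
    · exact h
  have hj' : j ≠ Fin.rev ⟨0, zero_lt_one.trans hN⟩ := by
    rintro rfl
    linarith
  refine le_antisymm ?_ hlow
  rw [← hj]
  refine hev ?_
  rw [Fin.le_def, Fin.val_rev]
  have h3 : (j : ℕ) ≠ N - 1 := by
    intro h
    apply hj'
    ext
    rw [Fin.val_rev]
    simpa using h
  simp
  omega

/-- A zero of a product of linear factors with nonzero derivative is attained by one factor. -/
theorem unique_factor_of_deriv_ne_zero {ι : Type*} [Fintype ι] [DecidableEq ι] {e : ι → ℝ} {t : ℝ}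
    (h : deriv (fun s => ∏ i, (s - e i)) t ≠ 0) (i j : ι) (hi : e i = t) (hj : e j = t) :
    i = j := by
  by_contra hij
  apply h
  have h1 : HasDerivAt (fun s => ∏ i, (s - e i))
      (∑ k, (∏ l ∈ Finset.univ.erase k, (t - e l)) • (1 : ℝ)) t :=
    HasDerivAt.fun_finsetProd fun k _ => (hasDerivAt_id t).sub_const _
  rw [h1.deriv]
  refine Finset.sum_eq_zero fun k _ => ?_
  by_cases hk : k = i
  · rw [Finset.prod_eq_zero (i := j) (by simp [hk, Ne.symm hij]) (by simp [hj]), zero_smul]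
  · rw [Finset.prod_eq_zero (i := i) (by simp [Ne.symm hk]) (by simp [hi]), zero_smul]

/-- The two lowest eigenvalues of a family of Hermitian matrices that is similar to a perturbed
diagonal matrix with simple lowest entries `d i₀ < d i₁`. -/
theorem gap_of_perturbed_diagonal [CompleteSpace E] {d : m → ℝ} {w : m → m → E →L[ℝ] ℂ}
    {H : E → Matrix m m ℂ} (hH : ∀ x, (H x).IsHermitian)
    (hchar : ∀ x (t : ℝ), (H x).charpoly.eval (t : ℂ) =
      Matrix.det (Matrix.of fun i j => (if i = j then ((t - d i : ℝ) : ℂ) else 0) - w i j x))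
    {i₀ i₁ : m} (h01 : d i₀ < d i₁) (h1 : ∀ j, j ≠ i₀ → j ≠ i₁ → d i₁ < d j)
    (hcard : 1 < Fintype.card m) :
    ContDiffAt ℝ ω (fun x => energy (hH x) 1 hcard -
      energy (hH x) 0 (zero_lt_one.trans hcard)) 0 ∧
    HasFDerivAt (fun x => energy (hH x) 1 hcard - energy (hH x) 0 (zero_lt_one.trans hcard))
      (Complex.reCLM ∘L (w i₁ i₁ - w i₀ i₀)) 0 := by
  have hprod : ∀ x (t : ℝ), (H x).charpoly.eval (t : ℂ) =
      ((∏ i, (t - (hH x).eigenvalues₀ i) : ℝ) : ℂ) := by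
    intro x t
    rw [(hH x).charpoly_eq, Polynomial.eval_prod]
    simp only [Polynomial.eval_sub, Polynomial.eval_X, Polynomial.eval_C, Complex.ofReal_prod,
      Complex.ofReal_sub]
    exact Fintype.prod_equiv (Fintype.equivOfCardEq (Fintype.card_fin _)).symm
      (fun i => (t : ℂ) - ((hH x).eigenvalues i : ℂ)) _ fun i => rfl
  -- The characteristic polynomial of a Hermitian matrix is real at real `t`, so taking the real
  -- part loses nothing.
  have hp : ∀ x t, charFun d w (x, t) = ∏ i, (t - (hH x).eigenvalues₀ i) := by
    intro x t
    have := hprod x t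
    rw [hchar] at this
    simp only [charFun]
    rw [this, Complex.ofReal_re]
  have hroot : ∀ x t, charFun d w (x, t) = 0 ↔ ∃ i, (hH x).eigenvalues₀ i = t := by
    intro x t
    rw [hp, Finset.prod_eq_zero_iff]
    simp only [Finset.mem_univ, true_and, sub_eq_zero]
    exact exists_congr fun i => eq_comm
  obtain ⟨φ₀, hs₀, hz₀, hd₀, hu₀, hne⟩ := exists_simple_root (d := d) w (i₀ := i₀) (by
    intro j hj
    by_cases hj1 : j = i₁
    · rw [hj1]; exact h01.ne'
    · exact (h01.trans (h1 j hj hj1)).ne')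
  -- Simplicity of the second root is not needed: it is the second lowest eigenvalue whatever its
  -- multiplicity.
  obtain ⟨φ₁, hs₁, hz₁, hd₁, hu₁, -⟩ := exists_simple_root (d := d) w (i₀ := i₁) (by
    intro j hj
    by_cases hj0 : j = i₀
    · rw [hj0]; exact h01.ne
    · exact (h1 j hj0 hj).ne')
  obtain ⟨δ₀, hδ₀, hu₀⟩ := Metric.eventually_nhds_iff.1 hu₀
  obtain ⟨δ₁, hδ₁, hu₁⟩ := Metric.eventually_nhds_iff.1 hu₁
  -- This `δ` separates the windows around `d i₀`, around `d i₁` and around the remaining entries,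
  -- and keeps the first two inside the regions where the roots are unique.
  obtain ⟨δ, hδ, hδ01, hδ1, hδ₀', hδ₁'⟩ : ∃ δ > 0, d i₀ + 2 * δ < d i₁ ∧
      (∀ j, j ≠ i₀ → j ≠ i₁ → d i₁ + 2 * δ < d j) ∧ δ < δ₀ ∧ δ < δ₁ := by
    have hlim : ∀ a : ℝ, Tendsto (fun δ : ℝ => a + 2 * δ) (𝓝[>] 0) (𝓝 a) := by
      intro a
      have : Tendsto (fun δ : ℝ => a + 2 * δ) (𝓝 0) (𝓝 (a + 2 * 0)) :=
        (by fun_prop : Continuous fun δ : ℝ => a + 2 * δ).tendsto 0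
      simp only [mul_zero, add_zero] at this
      exact this.mono_left nhdsWithin_le_nhds
    have hsmall : ∀ a : ℝ, 0 < a → ∀ᶠ δ in 𝓝[>] (0 : ℝ), δ < a := fun a ha =>
      (tendsto_id.mono_left nhdsWithin_le_nhds).eventually_lt_const ha
    have hall : ∀ᶠ δ in 𝓝[>] (0 : ℝ), ∀ j, j ≠ i₀ → j ≠ i₁ → d i₁ + 2 * δ < d j := by
      rw [eventually_all]
      intro j
      by_cases hj : j ≠ i₀ ∧ j ≠ i₁
      · filter_upwards [(hlim (d i₁)).eventually_lt_const (h1 j hj.1 hj.2)] with δ h _ _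
        exact h
      · exact Eventually.of_forall fun δ h h' => absurd ⟨h, h'⟩ hj
    have := (((eventually_mem_nhdsWithin (a := (0 : ℝ)) (s := Set.Ioi 0)).and
      ((hlim (d i₀)).eventually_lt_const h01)).and hall).and
      ((hsmall δ₀ hδ₀).and (hsmall δ₁ hδ₁))
    obtain ⟨δ, ⟨⟨h2, h3⟩, h4⟩, h5, h6⟩ := this.exists
    exact ⟨δ, h2, h3, h4, h5, h6⟩
  have hclose : ∀ (φ : E → ℝ) (a : ℝ), ContDiffAt ℝ ω φ 0 → φ 0 = a →
      ∀ᶠ x in 𝓝 (0 : E), |φ x - a| < δ := by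
    intro φ a hφ ha
    have : Tendsto φ (𝓝 0) (𝓝 a) := ha ▸ hφ.continuousAt
    simpa [Real.dist_eq] using this.eventually (Metric.ball_mem_nhds a hδ)
  have hev : (fun x => energy (hH x) 1 hcard - energy (hH x) 0 (zero_lt_one.trans hcard))
      =ᶠ[𝓝 0] fun x => φ₁ x - φ₀ x := by
    filter_upwards [eventually_root_near_diagonal d w hδ, hne, hclose φ₀ _ hs₀ hz₀,
      hclose φ₁ _ hs₁ hz₁, Metric.ball_mem_nhds (0 : E) hδ₀, Metric.ball_mem_nhds (0 : E) hδ₁]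
      with x hnear hne hc₀ hc₁ hb₀ hb₁
    have hw₀ : ∀ t, |t - d i₀| < δ → (charFun d w (x, t) = 0 ↔ φ₀ x = t) := by
      intro t ht
      refine hu₀ (y := (x, t)) ?_
      rw [Prod.dist_eq]
      exact max_lt hb₀ (by simpa [Real.dist_eq] using ht.trans hδ₀')
    have hw₁ : ∀ t, |t - d i₁| < δ → (charFun d w (x, t) = 0 ↔ φ₁ x = t) := by
      intro t ht
      refine hu₁ (y := (x, t)) ?_
      rw [Prod.dist_eq]
      exact max_lt hb₁ (by simpa [Real.dist_eq] using ht.trans hδ₁')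
    rw [abs_lt] at hc₀ hc₁
    have hlt : φ₀ x < φ₁ x := by linarith [hc₀.2, hc₁.1]
    -- Every eigenvalue lies in some window: in the first it equals `φ₀ x`, in the second `φ₁ x`,
    -- and in the others it exceeds `φ₁ x`. The nonzero derivative excludes a repeated `φ₀ x`.
    have key := two_smallest_of_antitone hcard (hH x).eigenvalues₀_antitone hlt
      ((hroot x _).1 ((hw₀ _ (abs_lt.2 hc₀)).2 rfl)) ((hroot x _).1 ((hw₁ _ (abs_lt.2 hc₁)).2 rfl))
      (by
        intro i
        have hri : charFun d w (x, (hH x).eigenvalues₀ i) = 0 := (hroot x _).2 ⟨i, rfl⟩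
        obtain ⟨k, hk⟩ := hnear ((hH x).eigenvalues₀ i) (by
          rw [← hchar, hprod, Finset.prod_eq_zero (Finset.mem_univ i) (sub_self _)]
          simp)
        by_cases hk0 : k = i₀
        · subst hk0
          exact Or.inl ((hw₀ _ hk).1 hri).symm
        · by_cases hk1 : k = i₁
          · subst hk1
            exact Or.inr ((hw₁ _ hk).1 hri).le
          · right
            have := hδ1 k hk0 hk1
            rw [abs_lt] at hk
            linarith [hk.1, hc₁.2])
      (by
        intro i j hi hj
        refine unique_factor_of_deriv_ne_zero ?_ i j hi hj
        have hline : HasDerivAt (fun s => charFun d w (x, s))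
            (fderiv ℝ (charFun d w) (x, φ₀ x) (0, 1)) (φ₀ x) :=
          (((contDiff_charFun d w).differentiable (by simp)) (x, φ₀ x)).hasFDerivAt.comp_hasDerivAt
            (φ₀ x) ((hasDerivAt_const _ x).prodMk (hasDerivAt_id _))
        simp only [hp] at hline
        rw [hline.deriv]
        exact hne)
    simp only [energy]
    rw [key.1, key.2]
  refine ⟨(hs₁.sub hs₀).congr_of_eventuallyEq hev, ?_⟩
  refine ((hd₁.sub hd₀).congr_of_eventuallyEq hev).congr_fderiv ?_
  rw [ContinuousLinearMap.comp_sub]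

end Spectral

end HamLearn
end

noncomputable section
namespace HamLearn

/-! ### Rotation to the eigenbasis of the control Hamiltonian -/

section Rotation

open Matrix

/-- The tensor product of `n` single-qubit matrices. -/
def tens {n : ℕ} (B : Fin n → Matrix (Fin 2) (Fin 2) ℂ) : Matrix (Basis n) (Basis n) ℂ :=
  fun x y => ∏ j, B j (x j) (y j)

theorem tens_mul {n : ℕ} (B C : Fin n → Matrix (Fin 2) (Fin 2) ℂ) :
    tens B * tens C = tens fun j => B j * C j := by
  ext x y
  simp only [tens, mul_apply, ← Finset.prod_mul_distrib]
  rw [Finset.prod_univ_sum, Fintype.piFinset_univ]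

theorem tens_one {n : ℕ} : tens (fun _ : Fin n => (1 : Matrix (Fin 2) (Fin 2) ℂ)) = 1 := by
  ext x y
  simp only [tens, one_apply, Finset.prod_ite_zero, Finset.prod_const_one]
  congr 1
  simp [funext_iff]

/-- Columns: eigenvectors of `(-1)^s σ^{b+1}` for the eigenvalues `1` and `-1`. -/
def eigenCols : Fin 2 → Fin 3 → Matrix (Fin 2) (Fin 2) ℂ
  | 0, 0 => !![1, 1; 1, -1]
  | 1, 0 => !![1, 1; -1, 1]
  | 0, 1 => !![1, 1; Complex.I, -Complex.I]
  | 1, 1 => !![1, 1; -Complex.I, Complex.I]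
  | 0, 2 => !![1, 0; 0, 1]
  | 1, 2 => !![0, 1; 1, 0]

/-- The inverse of `eigenCols`. -/
def eigenRows : Fin 2 → Fin 3 → Matrix (Fin 2) (Fin 2) ℂ
  | 0, 0 => !![1 / 2, 1 / 2; 1 / 2, -(1 / 2)]
  | 1, 0 => !![1 / 2, -(1 / 2); 1 / 2, 1 / 2]
  | 0, 1 => !![1 / 2, -Complex.I / 2; 1 / 2, Complex.I / 2]
  | 1, 1 => !![1 / 2, Complex.I / 2; 1 / 2, -Complex.I / 2]
  | 0, 2 => !![1, 0; 0, 1]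
  | 1, 2 => !![0, 1; 1, 0]

theorem eigenRows_mul_eigenCols (s : Fin 2) (b : Fin 3) : eigenRows s b * eigenCols s b = 1 := by
  fin_cases s <;> fin_cases b <;> ext i j <;> fin_cases i <;> fin_cases j <;>
    simp [eigenRows, eigenCols, mul_apply, Fin.sum_univ_two] <;> ring_nf <;> norm_num

/-- The expectation value of `σ^c` in the eigenstate number `z` of `(-1)^s σ^{b+1}`. -/
def pauliMean (s : Fin 2) (b : Fin 3) (c : Fin 4) (z : Fin 2) : ℝ :=
  if c = 0 then 1 else if c = b.succ then (-1) ^ (s : ℕ) * (-1) ^ (z : ℕ) else 0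

theorem rotated_pauli_diag (s : Fin 2) (b : Fin 3) (c : Fin 4) (z : Fin 2) :
    (eigenRows s b * pauli c * eigenCols s b) z z = (pauliMean s b c z : ℂ) := by
  fin_cases s <;> fin_cases b <;> fin_cases c <;> fin_cases z <;>
    simp [eigenRows, eigenCols, mul_apply, Fin.sum_univ_two, pauli, pauliMean] <;>
    ring_nf <;> norm_num

theorem rotated_pauli_succ (s : Fin 2) (b : Fin 3) :
    eigenRows s b * pauli b.succ * eigenCols s b = ((-1 : ℂ) ^ (s : ℕ)) • !![1, 0; 0, -1] := by
  fin_cases s <;> fin_cases b <;> ext i j <;> fin_cases i <;> fin_cases j <;>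
    simp [eigenRows, eigenCols, mul_apply, Fin.sum_univ_two, pauli] <;>
    ring_nf <;> norm_num

theorem pauli_zero : pauli 0 = 1 := by
  ext i j
  fin_cases i <;> fin_cases j <;> simp [pauli]

variable {n : ℕ}

/-- The eigenbasis of the control Hamiltonian, as columns. -/
def ctrlCols (e : Expt n) : Matrix (Basis n) (Basis n) ℂ :=
  tens fun j => eigenCols (e.2.1 j) (e.2.2 j)

/-- The inverse of `ctrlCols`. -/
def ctrlRows (e : Expt n) : Matrix (Basis n) (Basis n) ℂ :=
  tens fun j => eigenRows (e.2.1 j) (e.2.2 j)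

theorem ctrlRows_mul_ctrlCols (e : Expt n) : ctrlRows e * ctrlCols e = 1 := by
  rw [ctrlRows, ctrlCols, tens_mul]
  simp only [eigenRows_mul_eigenCols, tens_one]

/-- A Pauli string in the eigenbasis of the control Hamiltonian. -/
def rotString (e : Expt n) (a : Fin n → Fin 4) : Matrix (Basis n) (Basis n) ℂ :=
  tens fun j => eigenRows (e.2.1 j) (e.2.2 j) * pauli (a j) * eigenCols (e.2.1 j) (e.2.2 j)

theorem rotString_eq (e : Expt n) (a : Fin n → Fin 4) :
    ctrlRows e * pauliString a * ctrlCols e = rotString e a := by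
  have : pauliString a = tens fun j => pauli (a j) := rfl
  rw [this, ctrlRows, ctrlCols, tens_mul, tens_mul, rotString]

theorem rotString_diag (e : Expt n) (a : Fin n → Fin 4) (z : Basis n) :
    rotString e a z z = ((∏ j, pauliMean (e.2.1 j) (e.2.2 j) (a j) (z j) : ℝ) : ℂ) := by
  simp only [rotString, tens, rotated_pauli_diag, Complex.ofReal_prod]

/-- The weight of qubit `j` in the control Hamiltonian. -/
def ctrlWeight (e : Expt n) (j : Fin n) : ℝ := if j = e.1 then 1 / 2 else 1

/-- Eigenvalues of `-H_ctrl`. -/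
def ctrlEnergy (e : Expt n) (x : Basis n) : ℝ := -∑ j, ctrlWeight e j * (-1) ^ (x j : ℕ)

theorem rotString_single (e : Expt n) (j : Fin n) :
    rotString e (Pi.single j (e.2.2 j).succ) =
      diagonal fun x => (-1 : ℂ) ^ (e.2.1 j : ℕ) * (-1 : ℂ) ^ (x j : ℕ) := by
  have hfac : ∀ l, eigenRows (e.2.1 l) (e.2.2 l) *
      pauli ((Pi.single j (e.2.2 j).succ : Fin n → Fin 4) l) * eigenCols (e.2.1 l) (e.2.2 l) =
      if l = j then ((-1 : ℂ) ^ (e.2.1 j : ℕ)) • !![1, 0; 0, -1] else 1 := by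
    intro l
    split_ifs with h
    · subst h
      rw [Pi.single_eq_same, rotated_pauli_succ]
    · rw [Pi.single_eq_of_ne h, pauli_zero, mul_one, eigenRows_mul_eigenCols]
  have hz : ∀ p q : Fin 2, (!![1, 0; 0, -1] : Matrix (Fin 2) (Fin 2) ℂ) p q =
      if p = q then (-1 : ℂ) ^ (p : ℕ) else 0 := by
    intro p q
    fin_cases p <;> fin_cases q <;> simp
  ext x y
  simp only [rotString, tens, hfac]
  rw [diagonal_apply]
  split_ifs with hxy
  · subst hxy
    rw [Finset.prod_eq_single j]
    · simp [hz]
    · intro l _ hl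
      simp [hl]
    · simp
  · obtain ⟨l, hl⟩ := Function.ne_iff.1 hxy
    refine Finset.prod_eq_zero (Finset.mem_univ l) ?_
    by_cases h : l = j
    · subst h
      simp [hz, hl]
    · simp [h, hl]

/-- The eigenbasis is ordered according to `s` and `β`, so the signs `(-1)^s` square away and the
spectrum depends on `k` alone. -/
theorem rotated_hamCtrl (e : Expt n) :
    ctrlRows e * hamCtrl e * ctrlCols e = diagonal fun x => ((-ctrlEnergy e x : ℝ) : ℂ) := by
  unfold hamCtrl
  rw [Finset.mul_sum, Finset.sum_mul]
  simp only [mul_smul_comm, smul_mul_assoc, pauliAt, rotString_eq, rotString_single]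
  ext x y
  rw [Matrix.sum_apply]
  simp only [Matrix.smul_apply, diagonal_apply, smul_eq_mul]
  split_ifs with hxy
  · simp only [ctrlEnergy, neg_neg, Complex.ofReal_sum]
    refine Finset.sum_congr rfl fun j _ => ?_
    have hs : (-1 : ℂ) ^ (e.2.1 j : ℕ) * (-1 : ℂ) ^ (e.2.1 j : ℕ) = 1 := by
      rw [← mul_pow]
      simp
    rw [mul_assoc, ← mul_assoc ((-1 : ℂ) ^ (e.2.1 j : ℕ)), hs, one_mul, ctrlWeight]
    split_ifs <;> simp
  · simp

/-- The Hamiltonian in the eigenbasis of the control Hamiltonian, as a linear map. -/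
def rotHam (e : Expt n) (x y : Basis n) : Coeffs n →L[ℝ] ℂ :=
  ∑ a : Label n, rotString e a.1 x y • (Complex.ofRealCLM ∘L EuclideanSpace.proj a)

theorem rotated_ham (e : Expt n) (μ : Coeffs n) (x y : Basis n) :
    (ctrlRows e * ham μ * ctrlCols e) x y = rotHam e x y μ := by
  unfold ham rotHam
  rw [Finset.mul_sum, Finset.sum_mul, Matrix.sum_apply]
  simp only [mul_smul_comm, smul_mul_assoc, rotString_eq, Matrix.smul_apply, smul_eq_mul]
  simp [mul_comm]

theorem eval_charpoly_hamTot (e : Expt n) (μ : Coeffs n) (t : ℝ) :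
    (hamTot μ 1 e).charpoly.eval (t : ℂ) =
      det (of fun x y => (if x = y then ((t - ctrlEnergy e x : ℝ) : ℂ) else 0) -
        rotHam e x y μ) := by
  have h1 := ctrlRows_mul_ctrlCols e
  have h2 : ctrlCols e * ctrlRows e = 1 := mul_eq_one_comm.1 h1
  -- Similarity is enough here, so the eigenvectors need not be normalised.
  have h3 : (ctrlRows e * hamTot μ 1 e * ctrlCols e).charpoly = (hamTot μ 1 e).charpoly := by
    rw [mul_assoc, charpoly_mul_comm, mul_assoc, h2, mul_one]
  rw [← h3, eval_charpoly]
  congr 1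
  rw [hamTot, Complex.ofReal_one, one_smul, mul_sub, sub_mul, rotated_hamCtrl]
  ext x y
  simp only [Matrix.sub_apply, rotated_ham, of_apply, scalar_apply, diagonal_apply]
  split_ifs
  · push_cast
    ring
  · ring

/-- Flipping a qubit costs twice its weight: 1 for qubit `k`, 2 for the others. The weight `1/2` in
the control Hamiltonian is there to make the flip of `k` the unique first excitation. -/
theorem ctrlEnergy_sub (e : Expt n) (x : Basis n) :
    ctrlEnergy e x - ctrlEnergy e 0 = ∑ j, 2 * ctrlWeight e j * (x j : ℕ) := by
  simp only [ctrlEnergy]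
  rw [sub_neg_eq_add, neg_add_eq_sub, ← Finset.sum_sub_distrib]
  refine Finset.sum_congr rfl fun j _ => ?_
  rcases Fin.exists_fin_two.1 ⟨x j, rfl⟩ with h | h
  · simp [h]
  · simp [h]; ring

theorem ctrlEnergy_excited (e : Expt n) :
    ctrlEnergy e (Pi.single e.1 1) - ctrlEnergy e 0 = 1 := by
  rw [ctrlEnergy_sub, Finset.sum_eq_single e.1]
  · simp [ctrlWeight]
  · intro j _ hj
    simp [hj]
  · simp

theorem ctrlEnergy_other (e : Expt n) (x : Basis n) (h0 : x ≠ 0) (h1 : x ≠ Pi.single e.1 1) :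
    2 ≤ ctrlEnergy e x - ctrlEnergy e 0 := by
  obtain ⟨j, hj, hxj⟩ : ∃ j, j ≠ e.1 ∧ x j ≠ 0 := by
    by_contra! h
    rcases Fin.exists_fin_two.1 ⟨x e.1, rfl⟩ with hk | hk
    · apply h0
      ext j
      by_cases hj : j = e.1
      · subst hj; simp [hk]
      · simp [h j hj]
    · apply h1
      ext j
      by_cases hj : j = e.1
      · subst hj; simp [hk]
      · simp [h j hj, hj]
  rw [ctrlEnergy_sub]
  have hx1 : x j = 1 := Fin.eq_one_of_ne_zero _ hxj
  have : 2 * ctrlWeight e j * ((x j : ℕ) : ℝ) ≤ ∑ j, 2 * ctrlWeight e j * ((x j : ℕ) : ℝ) := by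
    refine Finset.single_le_sum (f := fun j => 2 * ctrlWeight e j * ((x j : ℕ) : ℝ))
      (fun l _ => ?_) (Finset.mem_univ j)
    have : 0 ≤ ctrlWeight e l := by
      unfold ctrlWeight
      split_ifs <;> norm_num
    positivity
  simpa [hx1, ctrlWeight, hj] using this

/-! ### First-order response of the gaps, and its inversion -/

/-- The derivative at `0` of the gap at unit control strength. -/
def gapDeriv (e : Expt n) : Coeffs n →L[ℝ] ℝ :=
  Complex.reCLM ∘L (rotHam e (Pi.single e.1 1) (Pi.single e.1 1) - rotHam e 0 0)

theorem energyGap_contDiffAt_hasFDerivAt (e : Expt n) :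
    ContDiffAt ℝ ω (fun μ => energyGap μ 1 e) 0 ∧
      HasFDerivAt (fun μ => energyGap μ 1 e) (gapDeriv e) 0 :=
  gap_of_perturbed_diagonal (d := ctrlEnergy e) (fun μ => hamTot_isHermitian μ 1 e)
    (eval_charpoly_hamTot e) (i₀ := 0) (i₁ := Pi.single e.1 1)
    (by linarith [ctrlEnergy_excited e])
    (fun x h0 h1 => by linarith [ctrlEnergy_excited e, ctrlEnergy_other e x h0 h1])
    (one_lt_card_basis e.1)

theorem gapDeriv_apply (e : Expt n) (μ : Coeffs n) :
    gapDeriv e μ = ∑ a : Label n, μ a *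
      (∏ j, pauliMean (e.2.1 j) (e.2.2 j) (a.1 j) ((Pi.single e.1 1 : Basis n) j) -
        ∏ j, pauliMean (e.2.1 j) (e.2.2 j) (a.1 j) 0) := by
  have h : ∀ z : Basis n, (rotHam e z z μ).re =
      ∑ a : Label n, μ a * ∏ j, pauliMean (e.2.1 j) (e.2.2 j) (a.1 j) (z j) := by
    intro z
    simp only [rotHam, rotString_diag]
    rw [_root_.sum_apply, Complex.re_sum]
    refine Finset.sum_congr rfl fun a _ => ?_
    rw [_root_.smul_apply, smul_eq_mul, Complex.re_ofReal_mul, mul_comm]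
    simp
  simp only [gapDeriv, ContinuousLinearMap.comp_apply, _root_.sub_apply,
    Complex.reCLM_apply, Complex.sub_re, h, ← Finset.sum_sub_distrib, ← mul_sub]
  rfl

/-- The character of the signs `s` that detects the support of a Pauli string. -/
def supportSign (c : Fin 4) (s : Fin 2) : ℝ := if c = 0 then 1 else (-1) ^ (s : ℕ)

/-- Orthogonality of the characters of one sign bit: as a function of `s`, the mean is constant for
`c = 0`, proportional to `(-1)^s` for `c = b.succ`, and zero otherwise. For `a = 0` the direction
`b` plays no role. -/
theorem sum_supportSign_mul_pauliMean (a c : Fin 4) (b : Fin 3) (z : Fin 2)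
    (hb : a ≠ 0 → b.succ = a) :
    ∑ s, supportSign a s * pauliMean s b c z = if c = a then 2 * supportSign a z else 0 := by
  rw [Fin.sum_univ_two]
  by_cases ha : a = 0
  · subst ha
    by_cases hc : c = 0
    · subst hc
      norm_num [supportSign, pauliMean]
    · by_cases hcb : c = b.succ <;> simp [supportSign, pauliMean, hc, hcb]
  · have hb' := hb ha
    by_cases hc : c = 0
    · subst hc
      simp [supportSign, pauliMean, ha, Ne.symm ha]
    · by_cases hca : c = a
      · simp [supportSign, pauliMean, ha, hca, hb']
        ring
      · simp [supportSign, pauliMean, hc, hca, hb']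

/-- Fourier inversion in `s`: one-qubit orthogonality on every factor kills all strings except `a`.
What is left is `2 ^ n` times a sign, `+1` in the ground state and `-1` in the excited one because
`k` lies in the support of `a`; the difference is `-2 * 2 ^ n`. -/
theorem coeff_of_gapDeriv (a : Label n) (k : Fin n) (hk : a.1 k ≠ 0) (β : Fin n → Fin 3)
    (hβ : ∀ j, a.1 j ≠ 0 → (β j).succ = a.1 j) (μ : Coeffs n) :
    ∑ s : Fin n → Fin 2, (∏ j, supportSign (a.1 j) (s j)) * gapDeriv (k, s, β) μ =
      -(2 * 2 ^ n) * μ a := by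
  have hsum : ∀ (c : Label n) (z : Basis n),
      ∑ s : Fin n → Fin 2, (∏ j, supportSign (a.1 j) (s j)) *
        ∏ j, pauliMean (s j) (β j) (c.1 j) (z j) =
      if c = a then 2 ^ n * ∏ j, supportSign (a.1 j) (z j) else 0 := by
    intro c z
    simp only [← Finset.prod_mul_distrib]
    have h := Finset.prod_univ_sum (fun _ : Fin n => (Finset.univ : Finset (Fin 2)))
      fun j s => supportSign (a.1 j) s * pauliMean s (β j) (c.1 j) (z j)
    rw [Fintype.piFinset_univ] at h
    rw [← h]
    simp only [fun j => sum_supportSign_mul_pauliMean (a.1 j) (c.1 j) (β j) (z j) (hβ j)]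
    split_ifs with hca
    · subst hca
      simp [Finset.prod_mul_distrib]
    · obtain ⟨j, hj⟩ : ∃ j, c.1 j ≠ a.1 j := Function.ne_iff.1 fun h => hca (Subtype.ext h)
      exact Finset.prod_eq_zero (Finset.mem_univ j) (if_neg hj)
  have h0 : ∏ j, supportSign (a.1 j) ((0 : Basis n) j) = 1 :=
    Finset.prod_eq_one fun j _ => by simp [supportSign]
  have h1 : ∏ j, supportSign (a.1 j) ((Pi.single k 1 : Basis n) j) = -1 := by
    rw [Finset.prod_eq_single k]
    · simp [supportSign, hk]
    · intro j _ hj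
      simp [supportSign, hj]
    · simp
  simp only [gapDeriv_apply, Finset.mul_sum]
  rw [Finset.sum_comm]
  have h2 : ∀ c : Label n, ∑ s : Fin n → Fin 2, (∏ j, supportSign (a.1 j) (s j)) * (μ c *
      (∏ j, pauliMean (s j) (β j) (c.1 j) ((Pi.single k 1 : Basis n) j) -
        ∏ j, pauliMean (s j) (β j) (c.1 j) 0)) = if c = a then -(2 * 2 ^ n) * μ a else 0 := by
    intro c
    have h3 := hsum c (Pi.single k 1)
    have h4 := hsum c 0
    rw [h1] at h3
    rw [h0] at h4
    have h5 : ∀ s : Fin n → Fin 2, (∏ j, supportSign (a.1 j) (s j)) * (μ c *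
        (∏ j, pauliMean (s j) (β j) (c.1 j) ((Pi.single k 1 : Basis n) j) -
          ∏ j, pauliMean (s j) (β j) (c.1 j) 0)) =
        μ c * ((∏ j, supportSign (a.1 j) (s j)) *
          ∏ j, pauliMean (s j) (β j) (c.1 j) ((Pi.single k 1 : Basis n) j)) -
        μ c * ((∏ j, supportSign (a.1 j) (s j)) *
          ∏ j, pauliMean (s j) (β j) (c.1 j) ((0 : Basis n) j)) := by
      intro s
      simp only [Pi.zero_apply]
      ring
    simp only [h5, Finset.sum_sub_distrib, ← Finset.mul_sum, h3, h4]
    split_ifs with hca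
    · subst hca
      ring
    · ring
  rw [Finset.sum_congr rfl fun c _ => h2 c]
  simp

/-- The derivative at `0` of the gap vector at unit control strength. -/
def gapVecDeriv (n : ℕ) : Coeffs n →L[ℝ] Gaps n :=
  (EuclideanSpace.equiv (Expt n) ℝ).symm.toContinuousLinearMap ∘L
    ContinuousLinearMap.pi fun e => gapDeriv e

theorem gapVecDeriv_injective (n : ℕ) : Function.Injective (gapVecDeriv n) := by
  rw [injective_iff_map_eq_zero]
  intro μ hμ
  have hzero : ∀ e : Expt n, gapDeriv e μ = 0 := fun e => congrArg (fun v : Gaps n => v e) hμ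
  ext a
  obtain ⟨k, hk⟩ : ∃ k, a.1 k ≠ 0 := Function.ne_iff.1 a.2
  have := coeff_of_gapDeriv a k hk
    (fun j => if h : a.1 j = 0 then 0 else (a.1 j).pred h) (by
      intro j hj
      simp [hj]) μ
  simp only [hzero, mul_zero, Finset.sum_const_zero] at this
  simpa using this

theorem gapVec_contDiffAt (n : ℕ) : ContDiffAt ℝ ω (gapVec (n := n) 1) 0 :=
  contDiffAt_euclidean.2 fun e => (energyGap_contDiffAt_hasFDerivAt e).1

theorem gapVec_hasFDerivAt (n : ℕ) : HasFDerivAt (gapVec (n := n) 1) (gapVecDeriv n) 0 :=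
  by
  rw [← hasFDerivWithinAt_univ]
  exact hasFDerivWithinAt_euclidean.2 fun e =>
    (energyGap_contDiffAt_hasFDerivAt e).2.hasFDerivWithinAt

end Rotation

/-! ### Scaling -/

/-- The roots with multiplicity have only one decreasing enumeration. -/
theorem eigenvalues₀_eq_of_charpoly {m : Type} [Fintype m] [DecidableEq m] {A : Matrix m m ℂ}
    (hA : A.IsHermitian) {f : Fin (Fintype.card m) → ℝ} (hf : Antitone f)
    (h : A.charpoly = ∏ i, (Polynomial.X - Polynomial.C (f i : ℂ))) : hA.eigenvalues₀ = f := by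
  have hroots : A.charpoly.roots = Multiset.map (fun i => (f i : ℂ)) Finset.univ.val := by
    rw [h, ← Polynomial.roots_multiset_prod_X_sub_C (Multiset.map _ _), Multiset.map_map]
    rfl
  rw [← List.ofFn_inj, ← hA.sort_roots_charpoly_eq_eigenvalues₀, hroots]
  simp_rw [Fin.univ_val_map, Multiset.map_coe, List.map_ofFn, Function.comp_def,
    RCLike.re_eq_complex_re, Complex.ofReal_re, Multiset.coe_sort]
  apply List.mergeSort_of_pairwise
  simp_rw [decide_eq_true_eq, ← List.sortedGE_iff_pairwise]
  exact hf.sortedGE_ofFn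

theorem eigenvalues₀_smul {m : Type} [Fintype m] [DecidableEq m] {A B : Matrix m m ℂ}
    (hA : A.IsHermitian) (hB : B.IsHermitian) {c : ℝ} (hc : 0 < c) (h : B = (c : ℂ) • A) :
    hB.eigenvalues₀ = fun i => c * hA.eigenvalues₀ i := by
  refine eigenvalues₀_eq_of_charpoly hB
    (fun i j hij => mul_le_mul_of_nonneg_left (hA.eigenvalues₀_antitone hij) hc.le) ?_
  have hc' : (c : ℂ) ≠ 0 := Complex.ofReal_ne_zero.2 hc.ne'
  refine Polynomial.funext fun z => ?_
  have h1 : Matrix.scalar m z - B = (c : ℂ) • (Matrix.scalar m (z / c) - A) := by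
    rw [h, smul_sub]
    congr 1
    ext i j
    simp [Matrix.diagonal_apply]
    field_simp
  rw [Matrix.eval_charpoly, h1, Matrix.det_smul, ← Matrix.eval_charpoly, hA.charpoly_eq,
    Polynomial.eval_prod, Polynomial.eval_prod]
  simp only [Polynomial.eval_sub, Polynomial.eval_X, Polynomial.eval_C]
  have h2 : (c : ℂ) ^ Fintype.card m = ∏ _i : m, (c : ℂ) := by
    rw [Finset.prod_const, Finset.card_univ]
  rw [h2, ← Finset.prod_mul_distrib]
  refine Fintype.prod_equiv (Fintype.equivOfCardEq (Fintype.card_fin _)).symm _ _ fun i => ?_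
  change (c : ℂ) * (z / c - (hA.eigenvalues₀ _ : ℂ)) = _
  push_cast
  field_simp

/-- `hamTot` is jointly homogeneous in `(μ, ν)`, and a positive factor preserves the order of the
eigenvalues. This turns strong fields into an expansion at `0`. -/
theorem energyGap_scale {n : ℕ} {ν : ℝ} (hν : 0 < ν) (μ : Coeffs n) (e : Expt n) :
    energyGap μ ν e = ν * energyGap (ν⁻¹ • μ) 1 e := by
  have h : hamTot μ ν e = (ν : ℂ) • hamTot (ν⁻¹ • μ) 1 e := by
    have hν' : (ν : ℂ) ≠ 0 := Complex.ofReal_ne_zero.2 hν.ne'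
    simp only [hamTot, smul_sub, Complex.ofReal_one, one_smul]
    congr 1
    simp only [ham, Finset.smul_sum, smul_smul]
    refine Finset.sum_congr rfl fun a _ => ?_
    congr 1
    simp
    field_simp
  simp only [energyGap, energy, eigenvalues₀_smul (hamTot_isHermitian _ 1 e)
    (hamTot_isHermitian μ ν e) hν h]
  ring

theorem gapVec_scale {n : ℕ} {ν : ℝ} (hν : 0 < ν) (μ : Coeffs n) :
    gapVec ν μ = ν • gapVec 1 (ν⁻¹ • μ) := by
  ext e
  exact energyGap_scale hν μ e

end HamLearn
end

noncomputable section
namespace HamLearn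

/-! ### Nonlinear least squares for a map with nearly constant derivative -/

section LeastSquares

open Metric
open scoped RealInnerProductSpace Topology

set_option linter.unusedSectionVars false

variable {ι : Type*} [Fintype ι] [DecidableEq ι]
  {W : Type*} [NormedAddCommGroup W] [InnerProductSpace ℝ W]

/-- The gradient of `μ ↦ ½ ‖y - F μ‖²`. -/
def lsGrad (F : EuclideanSpace ℝ ι → W) (y : W) (μ : EuclideanSpace ℝ ι) : EuclideanSpace ℝ ι :=
  WithLp.toLp 2 fun a => ⟪F μ - y, fderiv ℝ F μ (EuclideanSpace.single a 1)⟫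

/-- The forward finite-difference approximation of `lsGrad` with step `h`. -/
def fdGrad (F : EuclideanSpace ℝ ι → W) (y : W) (h : ℝ) (μ : EuclideanSpace ℝ ι) :
    EuclideanSpace ℝ ι :=
  WithLp.toLp 2 fun a => ⟪F μ - y, h⁻¹ • (F (μ + h • EuclideanSpace.single a 1) - F μ)⟫

theorem euclidean_eq_sum_single (v : EuclideanSpace ℝ ι) :
    v = ∑ a, v a • EuclideanSpace.single a (1 : ℝ) := by
  ext b
  simp [Finset.sum_apply, Pi.single_apply]

theorem inner_lsGrad (F : EuclideanSpace ℝ ι → W) (y : W) (μ v : EuclideanSpace ℝ ι) :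
    ⟪lsGrad F y μ, v⟫ = ⟪F μ - y, fderiv ℝ F μ v⟫ := by
  conv_rhs => rw [euclidean_eq_sum_single v]
  rw [map_sum, inner_sum, PiLp.inner_apply]
  refine Finset.sum_congr rfl fun a _ => ?_
  rw [map_smul, inner_smul_right]
  simp [lsGrad]

theorem euclidean_norm_le_card_mul {v : EuclideanSpace ℝ ι} {C : ℝ} (h : ∀ a, |v a| ≤ C) :
    ‖v‖ ≤ Fintype.card ι * C := by
  rw [euclidean_eq_sum_single v]
  refine (norm_sum_le _ _).trans ?_
  calc ∑ a, ‖v a • EuclideanSpace.single a (1 : ℝ)‖ ≤ ∑ _a : ι, C :=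
        Finset.sum_le_sum fun a _ => by simpa [norm_smul] using h a
    _ = Fintype.card ι * C := by simp

/-- A bound on the residuals in the ball of radius `4`. -/
def residualBound (M : ℝ) : ℝ := 4 * (M + 1) + 1

/-- `F` is smooth on the ball of radius `4` around `lam`, and its derivative is `δ`-close to `A`
and `δ`-Lipschitz there, with `δ` small in terms of the bounds `c` and `M` on `A`. -/
structure NearlyLinear (F : EuclideanSpace ℝ ι → W) (A : EuclideanSpace ℝ ι →L[ℝ] W)
    (c M δ : ℝ) (lam : EuclideanSpace ℝ ι) : Prop where
  c_pos : 0 < c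
  M_nonneg : 0 ≤ M
  δ_nonneg : 0 ≤ δ
  δ_le_one : δ ≤ 1
  lower : ∀ x, c * ‖x‖ ≤ ‖A x‖
  upper : ‖A‖ ≤ M
  small : δ * (2 * M + 1 + residualBound M) ≤ c ^ 2 / 2
  smooth : ContDiffOn ℝ ∞ F (ball lam 4)
  near : ∀ μ ∈ ball lam 4, ‖fderiv ℝ F μ - A‖ ≤ δ
  lip : ∀ μ ∈ ball lam 4, ∀ μ' ∈ ball lam 4, ‖fderiv ℝ F μ - fderiv ℝ F μ'‖ ≤ δ * ‖μ - μ'‖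

/-- The Lipschitz constant of the gradient. -/
def gradLip (M : ℝ) : ℝ := (M + 1) ^ 2 + residualBound M

namespace NearlyLinear

variable {F : EuclideanSpace ℝ ι → W} {A : EuclideanSpace ℝ ι →L[ℝ] W}
  {c M δ : ℝ} {lam : EuclideanSpace ℝ ι} {y : W} {μ μ' : EuclideanSpace ℝ ι}

theorem residualBound_pos (hF : NearlyLinear F A c M δ lam) : 0 < residualBound M := by
  have := hF.M_nonneg
  unfold residualBound
  positivity

theorem contDiffAt (hF : NearlyLinear F A c M δ lam) (hμ : μ ∈ ball lam 4) :
    ContDiffAt ℝ ∞ F μ :=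
  hF.smooth.contDiffAt (isOpen_ball.mem_nhds hμ)

theorem differentiableAt (hF : NearlyLinear F A c M δ lam) (hμ : μ ∈ ball lam 4) :
    DifferentiableAt ℝ F μ :=
  (hF.contDiffAt hμ).differentiableAt (by simp)

theorem norm_fderiv_le (hF : NearlyLinear F A c M δ lam) (hμ : μ ∈ ball lam 4) :
    ‖fderiv ℝ F μ‖ ≤ M + 1 := by
  have h1 := norm_le_norm_add_norm_sub A (fderiv ℝ F μ)
  have h2 := hF.near μ hμ
  rw [norm_sub_rev] at h2
  linarith [hF.upper, hF.δ_le_one]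

theorem norm_sub_sub_le (hF : NearlyLinear F A c M δ lam) (hμ : μ ∈ ball lam 4)
    (hμ' : μ' ∈ ball lam 4) : ‖F μ - F μ' - A (μ - μ')‖ ≤ δ * ‖μ - μ'‖ :=
  (convex_ball lam 4).norm_image_sub_le_of_norm_fderiv_le'
    (fun _ hx => hF.differentiableAt hx) hF.near hμ' hμ

theorem norm_sub_le (hF : NearlyLinear F A c M δ lam) (hμ : μ ∈ ball lam 4)
    (hμ' : μ' ∈ ball lam 4) : ‖F μ - F μ'‖ ≤ (M + 1) * ‖μ - μ'‖ :=
  (convex_ball lam 4).norm_image_sub_le_of_norm_fderiv_le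
    (fun _ hx => hF.differentiableAt hx) (fun _ hx => hF.norm_fderiv_le hx) hμ' hμ

/-- Mean value inequality on the segment, where the derivative differs from its value at `μ` by at
most `δ * ‖μ' - μ‖`. -/
theorem taylor (hF : NearlyLinear F A c M δ lam) (hμ : μ ∈ ball lam 4) (hμ' : μ' ∈ ball lam 4) :
    ‖F μ' - F μ - fderiv ℝ F μ (μ' - μ)‖ ≤ δ * ‖μ' - μ‖ ^ 2 := by
  have hseg : segment ℝ μ μ' ⊆ ball lam 4 := (convex_ball lam 4).segment_subset hμ hμ'
  have := (convex_segment μ μ').norm_image_sub_le_of_norm_fderiv_le' (C := δ * ‖μ' - μ‖)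
    (φ := fderiv ℝ F μ) (fun x hx => hF.differentiableAt (hseg hx)) (fun x hx => by
      refine (hF.lip x (hseg hx) μ hμ).trans ?_
      exact mul_le_mul_of_nonneg_left (norm_sub_le_of_mem_segment hx) hF.δ_nonneg)
    (left_mem_segment ℝ μ μ') (right_mem_segment ℝ μ μ')
  rwa [mul_assoc, ← sq] at this

theorem residual_le (hF : NearlyLinear F A c M δ lam) (hμ : μ ∈ ball lam 4)
    (hy : ‖y - F lam‖ ≤ 1) : ‖F μ - y‖ ≤ residualBound M := by
  have h1 := hF.norm_sub_le hμ (mem_ball_self (by norm_num))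
  have h2 : ‖μ - lam‖ ≤ 4 := (mem_ball_iff_norm.1 hμ).le
  have h3 : ‖F μ - y‖ ≤ ‖F μ - F lam‖ + ‖y - F lam‖ := by
    rw [norm_sub_rev y]
    exact norm_sub_le_norm_sub_add_norm_sub _ _ _
  have h4 : (M + 1) * ‖μ - lam‖ ≤ (M + 1) * 4 :=
    mul_le_mul_of_nonneg_left h2 (by linarith [hF.M_nonneg])
  unfold residualBound
  linarith

/-- The first term would be all there is for linear `F`; the second is the residual against the
change of derivative. Monotonicity and Lipschitz bound both start here. -/
theorem inner_lsGrad_sub (F : EuclideanSpace ℝ ι → W) (y : W) (μ μ' v : EuclideanSpace ℝ ι) :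
    ⟪lsGrad F y μ - lsGrad F y μ', v⟫ = ⟪F μ - F μ', fderiv ℝ F μ v⟫ +
      ⟪F μ' - y, (fderiv ℝ F μ - fderiv ℝ F μ') v⟫ := by
  rw [inner_sub_left, inner_lsGrad, inner_lsGrad, _root_.sub_apply, inner_sub_right,
    ← sub_add_sub_cancel (F μ) (F μ') y, inner_add_left]
  ring

/-- Strong monotonicity of the gradient. -/
theorem strong_mono (hF : NearlyLinear F A c M δ lam) (hy : ‖y - F lam‖ ≤ 1)
    (hμ : μ ∈ ball lam 4) (hμ' : μ' ∈ ball lam 4) :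
    c ^ 2 / 2 * ‖μ - μ'‖ ^ 2 ≤ ⟪lsGrad F y μ - lsGrad F y μ', μ - μ'⟫ := by
  rw [inner_lsGrad_sub]
  -- The increment of `F` and the derivative along `Δ` are both `A Δ` plus an error of size `δ ‖Δ‖`,
  -- so the main term is `‖A Δ‖ ^ 2`, at least `c ^ 2 ‖Δ‖ ^ 2`.
  set Δ := μ - μ'
  set u := F μ - F μ' - A Δ with hu_def
  set v := (fderiv ℝ F μ - A) Δ with hv_def
  have hu : ‖u‖ ≤ δ * ‖Δ‖ := hF.norm_sub_sub_le hμ hμ'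
  have hv : ‖v‖ ≤ δ * ‖Δ‖ := (fderiv ℝ F μ - A).le_of_opNorm_le (hF.near μ hμ) Δ
  have hAΔ : ‖A Δ‖ ≤ M * ‖Δ‖ := A.le_of_opNorm_le hF.upper Δ
  have hw : ‖(fderiv ℝ F μ - fderiv ℝ F μ') Δ‖ ≤ δ * ‖Δ‖ * ‖Δ‖ :=
    (fderiv ℝ F μ - fderiv ℝ F μ').le_of_opNorm_le (hF.lip μ hμ μ' hμ') Δ
  have hres := hF.residual_le hμ' hy
  have e1 : F μ - F μ' = A Δ + u := by rw [hu_def]; abel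
  have e2 : fderiv ℝ F μ Δ = A Δ + v := by rw [hv_def, _root_.sub_apply]; abel
  rw [e1, e2, inner_add_left, inner_add_right, inner_add_right, real_inner_self_eq_norm_sq]
  have hδ := hF.δ_nonneg
  have hΔ := norm_nonneg Δ
  have hM := hF.M_nonneg
  have i1 := (abs_le.1 (abs_real_inner_le_norm (A Δ) v)).1
  have i2 := (abs_le.1 (abs_real_inner_le_norm u (A Δ))).1
  have i3 := (abs_le.1 (abs_real_inner_le_norm u v)).1
  have i4 := (abs_le.1 (abs_real_inner_le_norm (F μ' - y) ((fderiv ℝ F μ - fderiv ℝ F μ') Δ))).1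
  have j1 : ‖A Δ‖ * ‖v‖ ≤ (M * ‖Δ‖) * (δ * ‖Δ‖) := by gcongr
  have j2 : ‖u‖ * ‖A Δ‖ ≤ (δ * ‖Δ‖) * (M * ‖Δ‖) := by gcongr
  have j3 : ‖u‖ * ‖v‖ ≤ (δ * ‖Δ‖) * (δ * ‖Δ‖) := by gcongr
  have j4 : ‖F μ' - y‖ * ‖(fderiv ℝ F μ - fderiv ℝ F μ') Δ‖ ≤
      residualBound M * (δ * ‖Δ‖ * ‖Δ‖) := by
    have := hF.residualBound_pos
    gcongr
  have j5 : (c * ‖Δ‖) ^ 2 ≤ ‖A Δ‖ ^ 2 := by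
    have := hF.c_pos
    gcongr
    exact hF.lower Δ
  -- Cross terms, the product of errors and the residual term together cost at most half of `c ^ 2`;
  -- the field `small` is designed for this.
  have j6 : δ * (2 * M + 1 + residualBound M) * ‖Δ‖ ^ 2 ≤ c ^ 2 / 2 * ‖Δ‖ ^ 2 :=
    mul_le_mul_of_nonneg_right hF.small (by positivity)
  have j7 : (δ * ‖Δ‖) * (δ * ‖Δ‖) ≤ δ * ‖Δ‖ ^ 2 := by
    have : δ * (δ * ‖Δ‖ ^ 2) ≤ 1 * (δ * ‖Δ‖ ^ 2) :=
      mul_le_mul_of_nonneg_right hF.δ_le_one (by positivity)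
    linarith
  linarith

/-- Lipschitz continuity of the gradient. -/
theorem lipschitz_lsGrad (hF : NearlyLinear F A c M δ lam) (hy : ‖y - F lam‖ ≤ 1)
    (hμ : μ ∈ ball lam 4) (hμ' : μ' ∈ ball lam 4) :
    ‖lsGrad F y μ - lsGrad F y μ'‖ ≤ gradLip M * ‖μ - μ'‖ := by
  set v := lsGrad F y μ - lsGrad F y μ' with hv
  have hM := hF.M_nonneg
  have hR := hF.residualBound_pos
  have h1 : ‖v‖ ^ 2 ≤ gradLip M * ‖μ - μ'‖ * ‖v‖ := by
    rw [← real_inner_self_eq_norm_sq]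
    conv_lhs => rw [hv, inner_lsGrad_sub, ← hv]
    have i1 := real_inner_le_norm (F μ - F μ') (fderiv ℝ F μ v)
    have i2 := real_inner_le_norm (F μ' - y) ((fderiv ℝ F μ - fderiv ℝ F μ') v)
    have j1 : ‖F μ - F μ'‖ * ‖fderiv ℝ F μ v‖ ≤ ((M + 1) * ‖μ - μ'‖) * ((M + 1) * ‖v‖) := by
      have a1 := hF.norm_sub_le hμ hμ'
      have a2 := (fderiv ℝ F μ).le_of_opNorm_le (hF.norm_fderiv_le hμ) v
      gcongr
    have j2 : ‖F μ' - y‖ * ‖(fderiv ℝ F μ - fderiv ℝ F μ') v‖ ≤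
        residualBound M * (1 * ‖μ - μ'‖ * ‖v‖) := by
      have a1 := hF.residual_le hμ' hy
      have a2 := (fderiv ℝ F μ - fderiv ℝ F μ').le_of_opNorm_le (hF.lip μ hμ μ' hμ') v
      have a3 : δ * ‖μ - μ'‖ * ‖v‖ ≤ 1 * ‖μ - μ'‖ * ‖v‖ := by
        have := hF.δ_le_one
        gcongr
      have a4 := a2.trans a3
      gcongr
    unfold gradLip
    linarith
  by_cases hv0 : ‖v‖ = 0
  · rw [hv0]
    unfold gradLip
    positivity
  · have : 0 < ‖v‖ := lt_of_le_of_ne (norm_nonneg _) (Ne.symm hv0)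
    rw [sq] at h1
    exact le_of_mul_le_mul_right h1 this

/-! ### Gradient descent as a contraction, and its fixed point -/

/-- Admissible step sizes of gradient descent. -/
def Admissible (c M η : ℝ) : Prop :=
  0 < η ∧ η * gradLip M ^ 2 ≤ c ^ 2 / 2 ∧ η * (c ^ 2 / 2) ≤ 1

/-- The contraction rate of gradient descent. -/
def rate (c η : ℝ) : ℝ := 1 - η * (c ^ 2 / 2) / 2

theorem rate_lt_one (hF : NearlyLinear F A c M δ lam) {η : ℝ} (hη : Admissible c M η) :
    rate c η < 1 := by
  have h1 := hF.c_pos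
  have h2 := hη.1
  have : 0 < η * (c ^ 2 / 2) / 2 := by positivity
  unfold rate
  linarith

theorem rate_pos {η : ℝ} (hη : Admissible c M η) : 0 < rate c η := by
  unfold rate
  linarith [hη.2.2]

/-- With `m = c ^ 2 / 2` and `L = gradLip M`, expanding the square gives the factor `1 - 2ηm +
η²L²`. Since `ηL² ≤ m`, this is at most `1 - ηm ≤ (1 - ηm/2)²`. -/
theorem contraction (hF : NearlyLinear F A c M δ lam) {η : ℝ} (hη : Admissible c M η)
    (hy : ‖y - F lam‖ ≤ 1) (hμ : μ ∈ ball lam 4) (hμ' : μ' ∈ ball lam 4) :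
    ‖(μ - η • lsGrad F y μ) - (μ' - η • lsGrad F y μ')‖ ≤ rate c η * ‖μ - μ'‖ := by
  have hq := (rate_pos hη).le
  refine le_of_sq_le_sq ?_ (by positivity)
  have e : (μ - η • lsGrad F y μ) - (μ' - η • lsGrad F y μ') =
      (μ - μ') - η • (lsGrad F y μ - lsGrad F y μ') := by
    rw [smul_sub]; abel
  rw [e, norm_sub_sq_real, real_inner_smul_right, norm_smul, real_inner_comm]
  have h1 := hF.strong_mono hy hμ hμ'
  have h2 := hF.lipschitz_lsGrad hy hμ hμ'
  set d := ‖μ - μ'‖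
  set G := ‖lsGrad F y μ - lsGrad F y μ'‖
  have hη0 := hη.1
  have h3 : G ^ 2 ≤ gradLip M ^ 2 * d ^ 2 := by
    rw [← mul_pow]
    gcongr
  have h4 : η * (η * G ^ 2) ≤ η * (c ^ 2 / 2 * d ^ 2) := by
    refine mul_le_mul_of_nonneg_left ?_ hη0.le
    calc η * G ^ 2 ≤ η * (gradLip M ^ 2 * d ^ 2) := mul_le_mul_of_nonneg_left h3 hη0.le
      _ = (η * gradLip M ^ 2) * d ^ 2 := by ring
      _ ≤ _ := mul_le_mul_of_nonneg_right hη.2.1 (sq_nonneg d)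
  have h5 := mul_le_mul_of_nonneg_left h1 hη0.le
  rw [Real.norm_of_nonneg hη0.le]
  have h6 : 0 ≤ (η * (c ^ 2 / 2) / 2) ^ 2 * d ^ 2 := by positivity
  unfold rate
  nlinarith

/-- The radius of the ball of data for which the least-squares problem is solved. -/
def dataRadius (c M : ℝ) : ℝ := min 1 (c ^ 2 / (8 * (M + 1)))

/-- The gradient is affine in the data, with linear part minus the adjoint of the derivative. -/
theorem norm_lsGrad_le (hF : NearlyLinear F A c M δ lam) (hμ : μ ∈ ball lam 4) {y' : W} :
    ‖lsGrad F y μ - lsGrad F y' μ‖ ≤ (M + 1) * ‖y - y'‖ := by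
  set v := lsGrad F y μ - lsGrad F y' μ with hv
  have h1 : ‖v‖ * ‖v‖ ≤ (M + 1) * ‖y - y'‖ * ‖v‖ := by
    rw [← real_inner_self_eq_norm_mul_norm]
    conv_lhs => rw [hv, inner_sub_left, inner_lsGrad, inner_lsGrad, ← inner_sub_left, ← hv]
    have e : F μ - y - (F μ - y') = y' - y := by abel
    rw [e, norm_sub_rev y y']
    refine (real_inner_le_norm _ _).trans ?_
    have a2 := (fderiv ℝ F μ).le_of_opNorm_le (hF.norm_fderiv_le hμ) v
    calc ‖y' - y‖ * ‖fderiv ℝ F μ v‖ ≤ ‖y' - y‖ * ((M + 1) * ‖v‖) := by gcongr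
      _ = _ := by ring
  by_cases hv0 : ‖v‖ = 0
  · rw [hv0]
    have := hF.M_nonneg
    positivity
  · exact le_of_mul_le_mul_right h1 (lt_of_le_of_ne (norm_nonneg _) (Ne.symm hv0))

theorem lsGrad_self (F : EuclideanSpace ℝ ι → W) (μ : EuclideanSpace ℝ ι) :
    lsGrad F (F μ) μ = 0 := by
  ext a
  simp [lsGrad]

/-- A lower bound for the gradient. -/
theorem antilipschitz (hF : NearlyLinear F A c M δ lam) (hy : ‖y - F lam‖ ≤ 1)
    (hμ : μ ∈ ball lam 4) (hμ' : μ' ∈ ball lam 4) :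
    c ^ 2 / 2 * ‖μ - μ'‖ ≤ ‖lsGrad F y μ - lsGrad F y μ'‖ := by
  have h1 := (hF.strong_mono hy hμ hμ').trans (real_inner_le_norm _ _)
  by_cases h0 : ‖μ - μ'‖ = 0
  · rw [h0, mul_zero]
    exact norm_nonneg _
  · have : 0 < ‖μ - μ'‖ := lt_of_le_of_ne (norm_nonneg _) (Ne.symm h0)
    rw [sq ‖μ - μ'‖, ← mul_assoc] at h1
    exact le_of_mul_le_mul_right h1 this

theorem eq_of_lsGrad_eq_zero (hF : NearlyLinear F A c M δ lam) (hy : ‖y - F lam‖ ≤ 1)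
    (hμ : μ ∈ ball lam 4) (hμ' : μ' ∈ ball lam 4) (h : lsGrad F y μ = 0)
    (h' : lsGrad F y μ' = 0) : μ = μ' := by
  have h1 := hF.antilipschitz hy hμ hμ'
  rw [h, h', sub_zero, norm_zero] at h1
  have h2 : 0 < c ^ 2 / 2 := by have := hF.c_pos; positivity
  rw [← sub_eq_zero, ← norm_eq_zero]
  exact le_antisymm (by nlinarith) (norm_nonneg _)

theorem dataRadius_mul_le (hF : NearlyLinear F A c M δ lam) (hy : ‖y - F lam‖ < dataRadius c M) :
    (M + 1) * ‖y - F lam‖ ≤ c ^ 2 / 2 / 4 := by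
  have hM : 0 < M + 1 := by linarith [hF.M_nonneg]
  have h1 : ‖y - F lam‖ ≤ c ^ 2 / (8 * (M + 1)) := hy.le.trans (min_le_right _ _)
  calc (M + 1) * ‖y - F lam‖ ≤ (M + 1) * (c ^ 2 / (8 * (M + 1))) := by gcongr
    _ = _ := by field_simp; ring

/-- Banach's fixed point theorem for the gradient step. `dataRadius` is chosen so that the centre
moves by at most `(1 - rate c η) / 2`, which makes the closed ball of radius `1/2` invariant. -/
theorem exists_critical_point (hF : NearlyLinear F A c M δ lam) {η : ℝ} (hη : Admissible c M η)
    (hy : ‖y - F lam‖ < dataRadius c M) :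
    ∃ μ ∈ closedBall lam (1 / 2), lsGrad F y μ = 0 := by
  have hy1 : ‖y - F lam‖ ≤ 1 := hy.le.trans (min_le_left _ _)
  have hsub : closedBall lam (1 / 2) ⊆ ball lam 4 := closedBall_subset_ball (by norm_num)
  have hlam : lam ∈ closedBall lam (1 / 2) := mem_closedBall_self (by norm_num)
  set T : EuclideanSpace ℝ ι → EuclideanSpace ℝ ι := fun μ => μ - η • lsGrad F y μ with hT
  have hmaps : Set.MapsTo T (closedBall lam (1 / 2)) (closedBall lam (1 / 2)) := by
    intro μ hμ
    have h1 := hF.contraction hη hy1 (hsub hμ) (hsub hlam)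
    rw [mem_closedBall_iff_norm] at hμ ⊢
    have h2 : T μ - lam = (T μ - T lam) + (-(η • lsGrad F y lam)) := by simp only [hT]; abel
    have h3 := hF.norm_lsGrad_le (y := y) (y' := F lam) (hsub hlam)
    rw [lsGrad_self, sub_zero] at h3
    have h4 := h3.trans (hF.dataRadius_mul_le hy)
    have h5 : rate c η * ‖μ - lam‖ ≤ rate c η * (1 / 2) :=
      mul_le_mul_of_nonneg_left hμ (rate_pos hη).le
    have h6 : η * ‖lsGrad F y lam‖ ≤ η * (c ^ 2 / 2 / 4) := mul_le_mul_of_nonneg_left h4 hη.1.le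
    calc ‖T μ - lam‖ ≤ ‖T μ - T lam‖ + ‖η • lsGrad F y lam‖ := by
          rw [h2, ← norm_neg (η • _)]
          exact norm_add_le _ _
      _ ≤ rate c η * (1 / 2) + η * (c ^ 2 / 2 / 4) := by
          rw [norm_smul, Real.norm_of_nonneg hη.1.le]
          exact add_le_add (h1.trans h5) h6
      _ = 1 / 2 := by unfold rate; ring
  have hcontr : ContractingWith ⟨rate c η, (rate_pos hη).le⟩ (hmaps.restrict T _ _) := by
    refine ⟨hF.rate_lt_one hη, LipschitzWith.of_dist_le_mul fun a b => ?_⟩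
    rw [Subtype.dist_eq, Subtype.dist_eq, dist_eq_norm, dist_eq_norm]
    exact hF.contraction hη hy1 (hsub a.2) (hsub b.2)
  obtain ⟨μ, hμ, hfix, -⟩ := hcontr.exists_fixedPoint' isClosed_closedBall.isComplete hmaps hlam
    (edist_ne_top _ _)
  refine ⟨μ, hμ, ?_⟩
  have h1 : μ - η • lsGrad F y μ = μ := hfix
  rw [sub_eq_self] at h1
  exact (smul_eq_zero.1 h1).resolve_left hη.1.ne'

theorem hasGradientAt_loss (hF : NearlyLinear F A c M δ lam) (hμ : μ ∈ ball lam 4) :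
    HasGradientAt (fun μ => (1 / 2 : ℝ) * ‖y - F μ‖ ^ 2) (lsGrad F y μ) μ := by
  rw [hasGradientAt_iff_hasFDerivAt]
  have h1 := (((hF.differentiableAt hμ).hasFDerivAt.const_sub y).norm_sq).const_mul (1 / 2 : ℝ)
  refine h1.congr_fderiv ?_
  ext v
  simp only [InnerProductSpace.toDual_apply_apply, inner_lsGrad]
  simp [inner_sub_left]

theorem hasGradientAt_loss_zero_iff (hF : NearlyLinear F A c M δ lam) (hμ : μ ∈ ball lam 4) :
    HasGradientAt (fun μ => (1 / 2 : ℝ) * ‖y - F μ‖ ^ 2) 0 μ ↔ lsGrad F y μ = 0 := by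
  have h := hF.hasGradientAt_loss (y := y) hμ
  refine ⟨fun h' => h.unique h', fun h' => ?_⟩
  rwa [h'] at h

/-- Along the segment leaving the critical point, strong monotonicity makes the derivative of the
loss positive. -/
theorem loss_lt_loss (hF : NearlyLinear F A c M δ lam) (hy : ‖y - F lam‖ ≤ 1)
    (hμ : μ ∈ ball lam 4) (hμ' : μ' ∈ ball lam 4) (h : lsGrad F y μ = 0) (hne : μ' ≠ μ) :
    (1 / 2 : ℝ) * ‖y - F μ‖ ^ 2 < (1 / 2 : ℝ) * ‖y - F μ'‖ ^ 2 := by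
  set L : EuclideanSpace ℝ ι → ℝ := fun μ => (1 / 2 : ℝ) * ‖y - F μ‖ ^ 2 with hL
  set Δ := μ' - μ with hΔ
  have hmem : ∀ t ∈ Set.Icc (0 : ℝ) 1, μ + t • Δ ∈ ball lam 4 := by
    intro t ht
    exact (convex_ball lam 4).add_smul_sub_mem hμ hμ' ht
  have hderiv : ∀ t ∈ Set.Icc (0 : ℝ) 1,
      HasDerivAt (fun t : ℝ => L (μ + t • Δ)) ⟪lsGrad F y (μ + t • Δ), Δ⟫ t := by
    intro t ht
    have h1 := (hasGradientAt_iff_hasFDerivAt.1 (hF.hasGradientAt_loss (y := y) (hmem t ht)))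
    have h2 : HasDerivAt (fun t : ℝ => μ + t • Δ) Δ t := by
      simpa using ((hasDerivAt_id t).smul_const Δ).const_add μ
    have h3 := h1.comp_hasDerivAt t h2
    rwa [InnerProductSpace.toDual_apply_apply] at h3
  have hmono : StrictMonoOn (fun t : ℝ => L (μ + t • Δ)) (Set.Icc 0 1) := by
    refine strictMonoOn_of_deriv_pos (convex_Icc 0 1)
      (fun t ht => (hderiv t ht).continuousAt.continuousWithinAt) fun t ht => ?_
    have ht' := interior_subset ht
    rw [interior_Icc] at ht
    rw [(hderiv t ht').deriv]
    have h1 := hF.strong_mono hy (hmem t ht') hμ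
    rw [h, sub_zero, add_sub_cancel_left, inner_smul_right] at h1
    have h2 : 0 < c ^ 2 / 2 * ‖t • Δ‖ ^ 2 := by
      have hc := hF.c_pos
      have : 0 < ‖t • Δ‖ := norm_pos_iff.2 (smul_ne_zero ht.1.ne' (sub_ne_zero.2 hne))
      positivity
    exact pos_of_mul_pos_right (h2.trans_le h1) ht.1.le
  have := hmono (Set.left_mem_Icc.2 zero_le_one) (Set.right_mem_Icc.2 zero_le_one) zero_lt_one
  simpa [hL, hΔ] using this

/-- Compare the two gradients at `μ'`: the one for `y'` vanishes there, and the one for `y` bounds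
the distance to `μ`. With `μ' = lam` this is the stability estimate; for nearby data it is the
continuity of the solution map. -/
theorem norm_critical_sub_le (hF : NearlyLinear F A c M δ lam) {y' : W} (hy : ‖y - F lam‖ ≤ 1)
    (hμ : μ ∈ ball lam 4) (hμ' : μ' ∈ ball lam 4)
    (h : lsGrad F y μ = 0) (h' : lsGrad F y' μ' = 0) :
    ‖μ - μ'‖ ≤ (M + 1) / (c ^ 2 / 2) * ‖y - y'‖ := by
  have h1 := hF.antilipschitz hy hμ hμ'
  have h2 := hF.norm_lsGrad_le (y := y) (y' := y') hμ'
  rw [h, zero_sub, norm_neg] at h1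
  rw [h', sub_zero] at h2
  have hc : 0 < c ^ 2 / 2 := by have := hF.c_pos; positivity
  rw [div_mul_eq_mul_div, le_div_iff₀ hc]
  linarith

theorem contDiffAt_lsGrad (hF : NearlyLinear F A c M δ lam) (hμ : μ ∈ ball lam 4) :
    ContDiffAt ℝ ∞ (fun z : W × EuclideanSpace ℝ ι => lsGrad F z.1 z.2) (y, μ) := by
  rw [contDiffAt_euclidean]
  intro a
  have h1 : ContDiffAt ℝ ∞ (fun z : W × EuclideanSpace ℝ ι => F z.2) (y, μ) :=
    (hF.contDiffAt hμ).comp (y, μ) contDiffAt_snd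
  have h2 : ContDiffAt ℝ ∞ (fun z : W × EuclideanSpace ℝ ι => fderiv ℝ F z.2) (y, μ) :=
    ((hF.contDiffAt hμ).fderiv_right (m := ∞) (by simp)).comp (y, μ) contDiffAt_snd
  exact (h1.sub contDiffAt_fst).inner ℝ (h2.clm_apply contDiffAt_const)

/-- Critical points depend smoothly on the data. -/
theorem contDiffAt_critical_point [CompleteSpace W] (hF : NearlyLinear F A c M δ lam) {η : ℝ}
    (hη : Admissible c M η) {g : W → EuclideanSpace ℝ ι} (hy : ‖y - F lam‖ < 1)
    (hg : ContinuousAt g y) (hgb : g y ∈ ball lam 4)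
    (hzero : ∀ᶠ y' in 𝓝 y, lsGrad F y' (g y') = 0) : ContDiffAt ℝ ∞ g y := by
  have hp := hF.contDiffAt_lsGrad (y := y) hgb
  set p := fun z : W × EuclideanSpace ℝ ι => lsGrad F z.1 z.2 with hp_def
  have hpd : HasFDerivAt p (fderiv ℝ p (y, g y)) (y, g y) :=
    (hp.differentiableAt (by simp)).hasFDerivAt
  set L := fderiv ℝ p (y, g y) ∘L .inr ℝ W (EuclideanSpace ℝ ι) with hL
  have hLd : HasFDerivAt (fun μ => lsGrad F y μ) L (g y) :=
    hpd.comp (g y) (hasFDerivAt_prodMk_right y (g y))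
  have hTd : HasFDerivAt (fun μ => μ - η • lsGrad F y μ) (.id ℝ _ - η • L) (g y) :=
    (hasFDerivAt_id (g y)).sub (hLd.const_smul η)
  -- The contraction estimate bounds the derivative of the step map, `‖1 - ηL‖ < 1`, so `L` is
  -- injective, hence invertible in finite dimension, and no Hessian has to be computed.
  have hnorm : ‖ContinuousLinearMap.id ℝ (EuclideanSpace ℝ ι) - η • L‖ ≤ rate c η := by
    refine hTd.le_of_lip' (rate_pos hη).le ?_
    filter_upwards [isOpen_ball.mem_nhds hgb] with μ hμ
    exact hF.contraction hη hy.le hμ hgb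
  have hinj : Function.Injective L := by
    rw [injective_iff_map_eq_zero]
    intro v hv
    have h1 := (ContinuousLinearMap.id ℝ (EuclideanSpace ℝ ι) - η • L).le_of_opNorm_le hnorm v
    have h2 : (ContinuousLinearMap.id ℝ (EuclideanSpace ℝ ι) - η • L) v = v := by simp [hv]
    rw [h2] at h1
    have h3 := hF.rate_lt_one hη
    rw [← norm_eq_zero]
    exact le_antisymm (by nlinarith [norm_nonneg v]) (norm_nonneg _)
  have hinv : L.IsInvertible := by
    refine ⟨(LinearEquiv.ofInjectiveEndo (L : EuclideanSpace ℝ ι →ₗ[ℝ] EuclideanSpace ℝ ι)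
      hinj).toContinuousLinearEquiv, ?_⟩
    ext v : 1
    rfl
  have hsmooth := hp.contDiffAt_implicitFunction (by simp) hinv
  refine hsmooth.congr_of_eventuallyEq ?_
  have hev := hp.eventually_apply_eq_iff_implicitFunction (by simp) hinv
  have htend : Filter.Tendsto (fun y' => (y', g y')) (𝓝 y) (𝓝 (y, g y)) :=
    (continuousAt_id.prodMk hg)
  filter_upwards [htend.eventually hev, hzero] with y' h1 h2
  refine (h1.1 ?_).symm
  simp only [hp_def]
  rw [h2, hzero.self_of_nhds]

/-- By `taylor` each difference quotient is off by at most `δ h ≤ h`; this is paired with a bounded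
residual. The radius 3 leaves room for a step `h ≤ 1`. -/
theorem norm_fdGrad_sub_le (hF : NearlyLinear F A c M δ lam) (hy : ‖y - F lam‖ ≤ 1) {h : ℝ}
    (h0 : 0 < h) (h1 : h ≤ 1) (hμ : μ ∈ ball lam 3) :
    ‖fdGrad F y h μ - lsGrad F y μ‖ ≤ Fintype.card ι * (residualBound M * h) := by
  have hμ4 : μ ∈ ball lam 4 := ball_subset_ball (by norm_num) hμ
  refine euclidean_norm_le_card_mul fun a => ?_
  have hμ' : μ + h • EuclideanSpace.single a (1 : ℝ) ∈ ball lam 4 := by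
    rw [mem_ball_iff_norm] at hμ ⊢
    have : ‖h • EuclideanSpace.single a (1 : ℝ)‖ ≤ 1 := by
      simpa [norm_smul, abs_of_pos h0] using h1
    have h2 : μ + h • EuclideanSpace.single a (1 : ℝ) - lam =
      (μ - lam) + h • EuclideanSpace.single a (1 : ℝ) := by abel
    rw [h2]
    linarith [norm_add_le (μ - lam) (h • EuclideanSpace.single a (1 : ℝ))]
  have ht := hF.taylor hμ4 hμ'
  rw [add_sub_cancel_left, map_smul] at ht
  have hn : ‖h • EuclideanSpace.single a (1 : ℝ)‖ = h := by simp [norm_smul, abs_of_pos h0]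
  rw [hn] at ht
  change |⟪F μ - y, h⁻¹ • (F (μ + h • EuclideanSpace.single a 1) - F μ)⟫ -
    ⟪F μ - y, fderiv ℝ F μ (EuclideanSpace.single a 1)⟫| ≤ _
  rw [← inner_sub_right]
  refine (abs_real_inner_le_norm _ _).trans ?_
  have e : h⁻¹ • (F (μ + h • EuclideanSpace.single a 1) - F μ) -
      fderiv ℝ F μ (EuclideanSpace.single a 1) =
      h⁻¹ • (F (μ + h • EuclideanSpace.single a 1) - F μ -
        h • fderiv ℝ F μ (EuclideanSpace.single a 1)) := by
    rw [smul_sub h⁻¹ (_ - _), smul_smul, inv_mul_cancel₀ h0.ne', one_smul]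
  have h2 : ‖h⁻¹ • (F (μ + h • EuclideanSpace.single a 1) - F μ -
        h • fderiv ℝ F μ (EuclideanSpace.single a 1))‖ ≤ h := by
    rw [norm_smul, norm_inv, Real.norm_of_nonneg h0.le, inv_mul_le_iff₀ h0]
    refine ht.trans ?_
    have := mul_le_mul_of_nonneg_right hF.δ_le_one (sq_nonneg h)
    linarith
  rw [e]
  have h3 := hF.residual_le hμ4 hy
  have := hF.residualBound_pos
  gcongr

/-- One step of gradient descent with finite differences. -/
theorem norm_step_sub_le (hF : NearlyLinear F A c M δ lam) {η : ℝ} (hη : Admissible c M η)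
    (hy : ‖y - F lam‖ ≤ 1) {h : ℝ} (h0 : 0 < h) (h1 : h ≤ 1) (hμ : μ ∈ ball lam 3)
    (hμ' : μ' ∈ ball lam 4) (hzero : lsGrad F y μ' = 0) :
    ‖(μ - η • fdGrad F y h μ) - μ'‖ ≤
      rate c η * ‖μ - μ'‖ + η * (Fintype.card ι * (residualBound M * h)) := by
  have hc := hF.contraction hη hy (ball_subset_ball (by norm_num) hμ) hμ'
  rw [hzero, smul_zero, sub_zero] at hc
  have e : (μ - η • fdGrad F y h μ) - μ' = (μ - η • lsGrad F y μ - μ') -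
      η • (fdGrad F y h μ - lsGrad F y μ) := by
    rw [smul_sub]; abel
  rw [e]
  refine (_root_.norm_sub_le _ _).trans (add_le_add hc ?_)
  rw [norm_smul, Real.norm_of_nonneg hη.1.le]
  exact mul_le_mul_of_nonneg_left (hF.norm_fdGrad_sub_le hy h0 h1 hμ) hη.1.le

end NearlyLinear

end LeastSquares

end HamLearn
end

noncomputable section
namespace HamLearn

/-! ### The program -/

section Program

variable {n : ℕ}

theorem Exec.of_eq {O : Coeffs n → Gaps n} {c : Prog n} {σ σ' : Store n} {q q' t t' : ℕ}
    (h : Exec O c σ σ' q t) (hq : q = q') (ht : t = t') : Exec O c σ σ' q' t' := by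
  subst hq ht
  exact h

/-- Run `c a` for every `a` in a list. -/
def forEach {α : Type*} (c : α → Prog n) : List α → Prog n
  | [] => .skip
  | a :: l => .seq (c a) (forEach c l)

/-- The invariant is indexed by the set of labels already treated, so the order of the list is
irrelevant. -/
theorem forEach_run {α : Type*} [DecidableEq α] {O : Coeffs n → Gaps n} {c : α → Prog n}
    {q t : ℕ} {I : Finset α → Store n → Prop}
    (hstep : ∀ a s σ, a ∉ s → I s σ → ∃ σ', Exec O (c a) σ σ' q t ∧ I (insert a s) σ') :
    ∀ (l : List α) (s : Finset α) (σ : Store n), l.Nodup → (∀ a ∈ l, a ∉ s) → I s σ →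
      ∃ σ', Exec O (forEach c l) σ σ' (l.length * q) (l.length * t) ∧ I (s ∪ l.toFinset) σ'
  | [], s, σ, _, _, h => ⟨σ, (Exec.skip σ).of_eq (by simp) (by simp), by simpa using h⟩
  | a :: l, s, σ, hl, hs, h => by
    rw [List.nodup_cons] at hl
    obtain ⟨σ₁, h₁, hI₁⟩ := hstep a s σ (hs a List.mem_cons_self) h
    obtain ⟨σ₂, h₂, hI₂⟩ := forEach_run hstep l (insert a s) σ₁ hl.2 (by
      intro b hb
      rw [Finset.mem_insert, not_or]
      exact ⟨fun e => hl.1 (e ▸ hb), hs b (List.mem_cons_of_mem _ hb)⟩) hI₁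
    refine ⟨σ₂, (Exec.seq h₁ h₂).of_eq ?_ ?_, ?_⟩
    · rw [List.length_cons]; ring
    · rw [List.length_cons]; ring
    · have : s ∪ (a :: l).toFinset = insert a s ∪ l.toFinset := by
        rw [List.toFinset_cons, Finset.union_insert, Finset.insert_union]
      rwa [this]

theorem forEach_univ_run {α : Type*} [DecidableEq α] [Fintype α] {O : Coeffs n → Gaps n}
    {c : α → Prog n} {q t : ℕ} {I : Finset α → Store n → Prop}
    (hstep : ∀ a s σ, a ∉ s → I s σ → ∃ σ', Exec O (c a) σ σ' q t ∧ I (insert a s) σ')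
    {σ : Store n} (h : I ∅ σ) :
    ∃ σ', Exec O (forEach c Finset.univ.toList) σ σ' (Fintype.card α * q) (Fintype.card α * t) ∧
      I Finset.univ σ' := by
  obtain ⟨σ', h1, h2⟩ := forEach_run hstep Finset.univ.toList ∅ σ (Finset.nodup_toList _)
    (by simp) h
  exact ⟨σ', by simpa using h1, by simpa using h2⟩

/-- A loop whose guard compares a register with a geometrically decreasing one. -/
theorem while_run {O : Coeffs n → Gaps n} {x y : Reg n} {c : Prog n} {Q T : ℕ} {θ : ℝ}
    {I : Store n → Prop}
    (hbody : ∀ σ, I σ → σ x < σ y →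
      ∃ σ', Exec O c σ σ' Q T ∧ I σ' ∧ σ' x = σ x ∧ σ' y = σ y * θ) :
    ∀ (m : ℕ) (σ : Store n), I σ → σ y * θ ^ m ≤ σ x →
      ∃ (σ' : Store n) (q t : ℕ), Exec O (.while x y c) σ σ' q t ∧ I σ' ∧ σ' x = σ x ∧
        σ' y ≤ σ' x ∧ q ≤ m * Q ∧ t ≤ m * (T + 1) + 1
  | 0, σ, hI, hm => by
    rw [pow_zero, mul_one] at hm
    exact ⟨σ, 0, 1, .while_false hm.not_gt, hI, rfl, hm, by simp, by simp⟩
  | m + 1, σ, hI, hm => by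
    by_cases h : σ x < σ y
    · obtain ⟨σ₁, h₁, hI₁, hx, hy⟩ := hbody σ hI h
      obtain ⟨σ₂, q, t, h₂, hI₂, hx₂, hle, hq, ht⟩ := while_run hbody m σ₁ hI₁ (by
        rw [hx, hy, mul_assoc, ← pow_succ']
        exact hm)
      refine ⟨σ₂, _, _, .while_true h h₁ h₂, hI₂, hx₂.trans hx, hle, ?_, ?_⟩
      · rw [Nat.succ_mul]; omega
      · rw [Nat.succ_mul]; omega
    · exact ⟨σ, 0, 1, .while_false h, hI, rfl, not_lt.1 h, by simp, by simp⟩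

/-- Register for the gap `e` at the current point. -/
def baseReg (e : Expt n) : Reg n := .tmp (8 + Fintype.equivFin (Expt n) e)

theorem baseReg_injective : Function.Injective (baseReg (n := n)) := by
  intro e e' h
  simp only [baseReg, Reg.tmp.injEq, Nat.add_left_cancel_iff] at h
  exact (Fintype.equivFin _).injective (Fin.ext h)

@[simp] theorem baseReg_inj {e e' : Expt n} : baseReg e = baseReg e' ↔ e = e' :=
  baseReg_injective.eq_iff

/-- The first eight work registers are reserved: 0 the decreasing threshold, 1 its ratio, 2 the
difference step, 3 the gain, 4 the constant zero, 5 the accumulator, 6 and 7 scratch. -/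
theorem baseReg_ne_tmp (e : Expt n) {i : ℕ} (hi : i < 8) : baseReg e ≠ .tmp i := by
  simp only [baseReg, ne_eq, Reg.tmp.injEq]
  omega

/-- `x := y`, by adding the zero register `tmp 4`. -/
def assign (x y : Reg n) : Prog n := .arith .add x y (.tmp 4)

/-- Adds the contribution of the gap `e` to `⟨E(arg) - E(cur), E(cur) - Ê⟩` in `tmp 5`. -/
def accumulate (e : Expt n) : Prog n :=
  .seq (.arith .sub (.tmp 6) (.ans e) (baseReg e)) <|
  .seq (.arith .sub (.tmp 7) (baseReg e) (.est e)) <|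
  .seq (.arith .mul (.tmp 6) (.tmp 6) (.tmp 7)) <|
  .arith .add (.tmp 5) (.tmp 5) (.tmp 6)

/-- Updates the coordinate `a`; `tmp 2` is the finite-difference step and `tmp 3` the gain. -/
def updateCoord (a : Label n) : Prog n :=
  .seq (.arith .add (.arg a) (.arg a) (.tmp 2)) <|
  .seq .query <|
  .seq (.const (.tmp 5) 0) <|
  .seq (forEach accumulate Finset.univ.toList) <|
  .seq (.arith .mul (.tmp 5) (.tmp 5) (.tmp 3)) <|
  .seq (assign (.arg a) (.cur a)) <|
  .arith .sub (.cur a) (.cur a) (.tmp 5)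

/-- One step of gradient descent with finite differences. -/
def descentStep (n : ℕ) : Prog n :=
  .seq (forEach (fun a => assign (.arg a) (.cur a)) Finset.univ.toList) <|
  .seq .query <|
  .seq (forEach (fun e => assign (baseReg e) (.ans e)) Finset.univ.toList) <|
  .seq (forEach updateCoord Finset.univ.toList) <|
  .arith .mul (.tmp 0) (.tmp 0) (.tmp 1)

/-- Gradient descent with step size `η`, finite-difference step `κ ε₁`, and as many iterations as
it takes for `4, 4θ, 4θ², …` to reach `ε₁`. -/
def descent (n : ℕ) (η κ θ : ℚ) : Prog n :=
  .seq (.const (.tmp 0) 4) <|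
  .seq (.const (.tmp 1) θ) <|
  .seq (.const (.tmp 2) κ) <|
  .seq (.arith .mul (.tmp 2) (.tmp 2) .tol) <|
  .seq (.const (.tmp 3) η) <|
  .seq (.arith .div (.tmp 3) (.tmp 3) (.tmp 2)) <|
  .while .tol (.tmp 0) (descentStep n)

/-! ### Correctness and cost of the program -/

theorem accumulate_exec (O : Coeffs n → Gaps n) (e : Expt n) (σ : Store n) :
    ∃ σ', Exec O (accumulate e) σ σ' 0 4 ∧
      σ' (.tmp 5) = σ (.tmp 5) + (σ (.ans e) - σ (baseReg e)) * (σ (baseReg e) - σ (.est e)) ∧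
      ∀ x, x ≠ .tmp 5 → x ≠ .tmp 6 → x ≠ .tmp 7 → σ' x = σ x := by
  have h6 := baseReg_ne_tmp e (i := 6) (by norm_num)
  refine ⟨_, .seq (.arith _ _ _ _ _) (.seq (.arith _ _ _ _ _) (.seq (.arith _ _ _ _ _)
    (.arith _ _ _ _ _))), ?_, ?_⟩
  · simp [Op.eval, h6]
  · intro x h5 h6 h7
    simp [Function.update_apply, h5, h6, h7]

theorem accumulate_all_exec (O : Coeffs n → Gaps n) (σ : Store n) :
    ∃ σ', Exec O (forEach accumulate Finset.univ.toList) σ σ' (Fintype.card (Expt n) * 0)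
        (Fintype.card (Expt n) * 4) ∧
      σ' (.tmp 5) = σ (.tmp 5) +
        ∑ e, (σ (.ans e) - σ (baseReg e)) * (σ (baseReg e) - σ (.est e)) ∧
      ∀ x, x ≠ .tmp 5 → x ≠ .tmp 6 → x ≠ .tmp 7 → σ' x = σ x := by
  refine forEach_univ_run (σ := σ) (I := fun s σ' => σ' (.tmp 5) = σ (.tmp 5) +
        ∑ e ∈ s, (σ (.ans e) - σ (baseReg e)) * (σ (baseReg e) - σ (.est e)) ∧
      ∀ x, x ≠ .tmp 5 → x ≠ .tmp 6 → x ≠ .tmp 7 → σ' x = σ x) ?_ (by simp)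
  rintro e s σ₁ he ⟨h1, h2⟩
  obtain ⟨σ₂, h3, h4, h5⟩ := accumulate_exec O e σ₁
  refine ⟨σ₂, h3, ?_, fun x a b c => (h5 x a b c).trans (h2 x a b c)⟩
  have hb := fun i hi => baseReg_ne_tmp e (i := i) hi
  rw [h4, h1, Finset.sum_insert he, h2 (.ans e) (by simp) (by simp) (by simp),
    h2 (.est e) (by simp) (by simp) (by simp),
    h2 (baseReg e) (hb 5 (by simp)) (hb 6 (by simp)) (hb 7 (by simp))]
  ring

/-- The argument of the oracle in a store. -/
def Store.point (σ : Store n) : Coeffs n := WithLp.toLp 2 fun a => σ (.arg a)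

theorem updateCoord_exec (O : Coeffs n → Gaps n) (a : Label n) (σ : Store n) :
    ∃ σ', Exec O (updateCoord a) σ σ' 1 (4 * Fintype.card (Expt n) + 5) ∧
      σ' (.cur a) = σ (.cur a) -
        (∑ e, (O (σ.point + σ (.tmp 2) • EuclideanSpace.single a 1) e - σ (baseReg e)) *
          (σ (baseReg e) - σ (.est e))) * σ (.tmp 3) ∧
      σ' (.arg a) = σ (.cur a) + σ (.tmp 4) ∧
      (∀ b, b ≠ a → σ' (.cur b) = σ (.cur b)) ∧
      (∀ b, b ≠ a → σ' (.arg b) = σ (.arg b)) ∧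
      (∀ e, σ' (.est e) = σ (.est e)) ∧ σ' .tol = σ .tol ∧
      (∀ e, σ' (baseReg e) = σ (baseReg e)) ∧ ∀ i < 5, σ' (.tmp i) = σ (.tmp i) := by
  have hb := fun (e : Expt n) i hi => baseReg_ne_tmp e (i := i) hi
  set σ₁ : Store n := Function.update σ (.arg a) (Op.eval .add (σ (.arg a)) (σ (.tmp 2))) with hσ₁
  set σ₂ : Store n := σ₁.query O with hσ₂
  set σ₃ : Store n := Function.update σ₂ (.tmp 5) ((0 : ℚ) : ℝ) with hσ₃
  have hans : ∀ e, σ₂ (.ans e) = O (σ.point + σ (.tmp 2) • EuclideanSpace.single a 1) e := by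
    intro e
    refine congrArg (fun v : Coeffs n => O v e) ?_
    ext b
    by_cases hba : b = a
    · subst hba
      simp [hσ₁, Store.point, Op.eval]
    · simp [hσ₁, Store.point, hba]
  have hq : ∀ x, (∀ e, x ≠ .ans e) → σ₂ x = σ₁ x := by
    intro x hx
    cases x <;> first | rfl | exact absurd rfl (hx _)
  have hσ : ∀ x, (∀ e, x ≠ .ans e) → x ≠ .arg a → x ≠ .tmp 5 → σ₃ x = σ x := by
    intro x h1 h2 h3
    rw [hσ₃, Function.update_of_ne h3, hq x h1, hσ₁, Function.update_of_ne h2]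
  obtain ⟨σ₄, h4, h5, h6⟩ := accumulate_all_exec O σ₃
  have h7 : ∀ x, (∀ e, x ≠ .ans e) → x ≠ .arg a → x ≠ .tmp 5 → x ≠ .tmp 6 → x ≠ .tmp 7 →
      σ₄ x = σ x := fun x a1 a2 a3 a4 a5 => (h6 x a3 a4 a5).trans (hσ x a1 a2 a3)
  have hbase : ∀ e, σ₃ (baseReg e) = σ (baseReg e) := fun e =>
    hσ _ (by simp [baseReg]) (by simp [baseReg]) (hb e 5 (by simp))
  have hest : ∀ e, σ₃ (.est e) = σ (.est e) := fun e => hσ _ (by simp) (by simp) (by simp)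
  have hans₃ : ∀ e, σ₃ (.ans e) = σ₂ (.ans e) := fun e => Function.update_of_ne (by simp) _ _
  have hacc : σ₃ (.tmp 5) = 0 := by simp [hσ₃]
  have hcur : ∀ b, σ₄ (.cur b) = σ (.cur b) := fun b => h7 _ (by simp) (by simp) (by simp)
    (by simp) (by simp)
  have htmp : ∀ i < 5, σ₄ (.tmp i) = σ (.tmp i) := fun i hi => h7 _ (by simp) (by simp)
    (by simp; omega) (by simp; omega) (by simp; omega)
  simp only [hacc, zero_add, hbase, hest, hans₃, hans] at h5
  refine ⟨_, Exec.of_eq (.seq (.arith _ _ _ _ _) (.seq (.query _) (.seq (.const _ _ _) (.seq h4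
    (.seq (.arith _ _ _ _ _) (.seq (.arith _ _ _ _ _) (.arith _ _ _ _ _))))))) (by ring) (by ring),
    ?_, ?_, ?_, ?_, ?_, ?_, ?_, ?_⟩
  · simp [Op.eval, hcur, htmp, h5]
  · simp [Op.eval, hcur, htmp]
  · intro b hba
    simp [hba, hcur]
  · intro b hba
    have : σ₄ (.arg b) = σ (.arg b) := h7 _ (by simp) (by simpa using hba) (by simp) (by simp)
      (by simp)
    simp [hba, this]
  · intro e
    have : σ₄ (.est e) = σ (.est e) := h7 _ (by simp) (by simp) (by simp) (by simp) (by simp)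
    simp [this]
  · have : σ₄ .tol = σ .tol := h7 _ (by simp) (by simp) (by simp) (by simp) (by simp)
    simp [this]
  · intro e
    have : σ₄ (baseReg e) = σ (baseReg e) := h7 _ (by simp [baseReg]) (by simp [baseReg])
      (hb e 5 (by simp)) (hb e 6 (by simp)) (hb e 7 (by simp))
    rw [Function.update_of_ne (by simp [baseReg]), Function.update_of_ne (by simp [baseReg]),
      Function.update_of_ne (hb e 5 (by simp)), this]
  · intro i hi
    rw [Function.update_of_ne (by simp), Function.update_of_ne (by simp),
      Function.update_of_ne (by simp; omega), htmp i hi]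

/-- The registers that one descent step does not change, apart from the iteration counter. -/
def SameInputs (σ σ' : Store n) : Prop :=
  (∀ e, σ' (.est e) = σ (.est e)) ∧ σ' .tol = σ .tol ∧ ∀ i < 5, σ' (.tmp i) = σ (.tmp i)

/-- Number of oracle calls of one descent step. -/
def stepQueries (n : ℕ) : ℕ := 1 + Fintype.card (Label n)

/-- Number of further steps of one descent step. -/
def stepTime (n : ℕ) : ℕ := Fintype.card (Label n) + Fintype.card (Expt n) +
  Fintype.card (Label n) * (4 * Fintype.card (Expt n) + 5) + 1

/-- Coordinates are overwritten one at a time, yet the effect is a simultaneous step: differences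
and residuals are read from `arg` and the base registers, and `arg a` is reset to the old coordinate
before `cur a` changes. -/
theorem updateAll_exec (O : Coeffs n → Gaps n) (σ : Store n) (hz : σ (.tmp 4) = 0)
    (harg : ∀ a, σ (.arg a) = σ (.cur a)) (hbase : ∀ e, σ (baseReg e) = O σ.output e)
    {η h : ℝ} (hh : σ (.tmp 2) = h) (hη : σ (.tmp 3) = η / h) {y : Gaps n}
    (hy : ∀ e, σ (.est e) = y e) :
    ∃ σ', Exec O (forEach updateCoord Finset.univ.toList) σ σ' (Fintype.card (Label n) * 1)
        (Fintype.card (Label n) * (4 * Fintype.card (Expt n) + 5)) ∧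
      σ'.output = σ.output - η • fdGrad O y h σ.output ∧ SameInputs σ σ' := by
  have hpoint : ∀ σ' : Store n, (∀ a, σ' (.arg a) = σ (.cur a)) → σ'.point = σ.output :=
    fun σ' h' => by
      ext a
      exact h' a
  obtain ⟨σ', h1, h2, h3, -, -⟩ := forEach_univ_run (O := O) (c := updateCoord (n := n))
    (q := 1) (t := 4 * Fintype.card (Expt n) + 5) (σ := σ)
    (I := fun s σ' => (∀ a, σ' (.cur a) = if a ∈ s then
        (σ.output - η • fdGrad O y h σ.output) a else σ (.cur a)) ∧ SameInputs σ σ' ∧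
        (∀ a, σ' (.arg a) = σ (.cur a)) ∧ ∀ e, σ' (baseReg e) = σ (baseReg e)) (by
      rintro a s σ₁ ha ⟨i1, ⟨i2, i3, i4⟩, i5, i6⟩
      obtain ⟨σ₂, j1, j2, j3, j4, j5, j6, j7, j8, j9⟩ := updateCoord_exec O a σ₁
      have hcur : σ₁ (.cur a) = σ (.cur a) := by rw [i1, if_neg ha]
      refine ⟨σ₂, j1, ?_, ⟨fun e => (j6 e).trans (i2 e), j7.trans i3,
        fun i hi => (j9 i hi).trans (i4 i hi)⟩, ?_, fun e => (j8 e).trans (i6 e)⟩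
      · intro b
        by_cases hba : b = a
        · subst hba
          rw [j2, hpoint σ₁ i5, hcur, i4 2 (by simp), i4 3 (by simp), hh, hη,
            if_pos (Finset.mem_insert_self _ _)]
          simp only [i6, i2, hbase, hy]
          change _ = σ (.cur b) - η * fdGrad O y h σ.output b
          congr 1
          simp only [fdGrad, PiLp.inner_apply]
          rw [Finset.sum_mul, Finset.mul_sum]
          refine Finset.sum_congr rfl fun e _ => ?_
          simp
          ring
        · rw [j4 b hba, i1]
          simp [hba]
      · intro b
        by_cases hba : b = a
        · subst hba
          rw [j3, hcur, i4 4 (by simp), hz, add_zero]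
        · rw [j5 b hba, i5])
    ⟨by simp, ⟨fun _ => rfl, rfl, fun _ _ => rfl⟩, harg, fun _ => rfl⟩
  refine ⟨σ', h1, ?_, h3⟩
  ext a
  exact (h2 a).trans (if_pos (Finset.mem_univ a))

theorem descentStep_exec (O : Coeffs n → Gaps n) (σ : Store n) (hz : σ (.tmp 4) = 0)
    {η h : ℝ} (hh : σ (.tmp 2) = h) (hη : σ (.tmp 3) = η / h) {y : Gaps n}
    (hy : ∀ e, σ (.est e) = y e) :
    ∃ σ', Exec O (descentStep n) σ σ' (stepQueries n) (stepTime n) ∧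
      σ'.output = σ.output - η • fdGrad O y h σ.output ∧
      (∀ e, σ' (.est e) = σ (.est e)) ∧ σ' .tol = σ .tol ∧
      (∀ i < 5, i ≠ 0 → σ' (.tmp i) = σ (.tmp i)) ∧ σ' (.tmp 0) = σ (.tmp 0) * σ (.tmp 1) := by
  obtain ⟨σ₁, h1, h2, h3⟩ := forEach_univ_run (O := O)
    (c := fun a : Label n => assign (.arg a) (.cur a)) (q := 0) (t := 1) (σ := σ)
    (I := fun s σ' => (∀ a ∈ s, σ' (.arg a) = σ (.cur a)) ∧ ∀ x, (∀ a, x ≠ .arg a) → σ' x = σ x)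
    (by
      rintro a s σ₁ ha ⟨i1, i2⟩
      refine ⟨_, .arith _ _ _ _ _, ?_, ?_⟩
      · intro b hb
        by_cases hba : b = a
        · subst hba
          simp [Op.eval, i2, hz]
        · rw [Function.update_of_ne (by simpa using hba)]
          exact i1 b ((Finset.mem_insert.1 hb).resolve_left hba)
      · intro x hx
        rw [Function.update_of_ne (hx a), i2 x hx])
    ⟨by simp, fun _ _ => rfl⟩
  set σ₂ : Store n := σ₁.query O with hσ₂
  have hq : ∀ x, (∀ e, x ≠ .ans e) → σ₂ x = σ₁ x := by
    intro x hx
    cases x <;> first | rfl | exact absurd rfl (hx _)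
  have hans : ∀ e, σ₂ (.ans e) = O σ.output e := by
    intro e
    simp only [hσ₂, Store.query, Store.output, h2 _ (Finset.mem_univ _)]
  have hz₂ : σ₂ (.tmp 4) = 0 := by rw [hq _ (by simp), h3 _ (by simp), hz]
  obtain ⟨σ₃, h4, h5, h6⟩ := forEach_univ_run (O := O)
    (c := fun e : Expt n => assign (baseReg e) (.ans e)) (q := 0) (t := 1) (σ := σ₂)
    (I := fun s σ' => (∀ e ∈ s, σ' (baseReg e) = σ₂ (.ans e)) ∧
      ∀ x, (∀ e, x ≠ baseReg e) → σ' x = σ₂ x)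
    (by
      rintro a s σ₁ ha ⟨i1, i2⟩
      refine ⟨_, .arith _ _ _ _ _, ?_, ?_⟩
      · intro b hb
        by_cases hba : b = a
        · subst hba
          have e1 := i2 (.tmp 4) (fun e => (baseReg_ne_tmp e (by simp)).symm)
          have e2 := i2 (.ans b) (by simp [baseReg])
          simp [Op.eval, e1, e2, hz₂]
        · rw [Function.update_of_ne (by simpa using hba)]
          exact i1 b ((Finset.mem_insert.1 hb).resolve_left hba)
      · intro x hx
        rw [Function.update_of_ne (hx a), i2 x hx])
    ⟨by simp, fun _ _ => rfl⟩
  have hbne : ∀ i < 5, ∀ e : Expt n, Reg.tmp i ≠ baseReg e := fun i hi e =>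
    (baseReg_ne_tmp e (by omega)).symm
  have htmp : ∀ i < 5, σ₃ (.tmp i) = σ (.tmp i) := fun i hi => by
    rw [h6 _ (hbne i hi), hq _ (by simp), h3 _ (by simp)]
  have hest : ∀ e, σ₃ (.est e) = σ (.est e) := fun e => by
    rw [h6 _ (by simp [baseReg]), hq _ (by simp), h3 _ (by simp)]
  have htol : σ₃ .tol = σ .tol := by
    rw [h6 _ (by simp [baseReg]), hq _ (by simp), h3 _ (by simp)]
  have hcur : ∀ a, σ₃ (.cur a) = σ (.cur a) := fun a => by
    rw [h6 _ (by simp [baseReg]), hq _ (by simp), h3 _ (by simp)]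
  have hout : σ₃.output = σ.output := by
    ext a
    exact hcur a
  obtain ⟨σ₄, h7, h8, h9, h10, h11⟩ := updateAll_exec O σ₃ (by rw [htmp 4 (by simp), hz])
    (fun a => by
      rw [hcur, h6 _ (by simp [baseReg]), hq _ (by simp), h2 _ (Finset.mem_univ _)])
    (fun e => by rw [hout, h5 _ (Finset.mem_univ _), hans])
    (by rw [htmp 2 (by simp), hh]) (by rw [htmp 3 (by simp), hη]) (fun e => by rw [hest, hy])
  refine ⟨_, Exec.of_eq (.seq h1 (.seq (.query _) (.seq h4 (.seq h7 (.arith _ _ _ _ _)))))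
    (by unfold stepQueries; ring) (by unfold stepTime; ring), ?_, ?_, ?_, ?_, ?_⟩
  · rw [← hout, ← h8]
    ext a
    simp [Store.output]
  · intro e
    rw [Function.update_of_ne (by simp), h9, hest]
  · rw [Function.update_of_ne (by simp), h10, htol]
  · intro i hi h0
    rw [Function.update_of_ne (by simpa using h0), h11 i hi, htmp i hi]
  · rw [Function.update_self, h11 0 (by simp), h11 1 (by simp), htmp 0 (by simp),
      htmp 1 (by simp)]
    rfl

/-- The factor in front of `log (1 / ε₁)` in the running time. -/
def costFactor (n : ℕ) (θ : ℝ) : ℝ :=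
  (3 / Real.log (1 / θ) + 2) * (stepQueries n + stepTime n + 1) + 14

/-- `m` is `log (4/ε) / log (1/θ)` rounded up. As `ε ≤ 1/2`, `log 4 ≤ 2 log (1/ε)` and the rounding
error is at most `1 ≤ 2 log (1/ε)`, whence the constants 3 and 2. -/
theorem exists_iteration_count {θ ε : ℝ} (hθ0 : 0 < θ) (hθ1 : θ < 1) (hε : 0 < ε)
    (hε2 : ε ≤ 1 / 2) :
    1 ≤ 2 * Real.log (1 / ε) ∧ ∃ m : ℕ, 4 * θ ^ m ≤ ε ∧
      (m : ℝ) ≤ (3 / Real.log (1 / θ) + 2) * Real.log (1 / ε) := by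
  have hlog2 : 1 / 2 < Real.log 2 := by linarith [Real.log_two_gt_d9]
  have hl : Real.log 2 ≤ Real.log (1 / ε) := by
    refine Real.log_le_log (by norm_num) ?_
    rw [le_div_iff₀ hε]
    linarith
  have hθl : 0 < Real.log (1 / θ) := Real.log_pos (by rwa [lt_div_iff₀ hθ0, one_mul])
  have hlog4 : Real.log (4 / ε) = 2 * Real.log 2 + Real.log (1 / ε) := by
    have : (4 : ℝ) / ε = 2 ^ 2 * (1 / ε) := by ring
    rw [this, Real.log_mul (by norm_num) (by positivity), Real.log_pow]
    norm_num
  refine ⟨by linarith, ⌈Real.log (4 / ε) / Real.log (1 / θ)⌉₊, ?_, ?_⟩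
  · have h1 := Nat.le_ceil (Real.log (4 / ε) / Real.log (1 / θ))
    set m := ⌈Real.log (4 / ε) / Real.log (1 / θ)⌉₊
    rw [div_le_iff₀ hθl] at h1
    have h2 : Real.log (4 * θ ^ m) ≤ Real.log ε := by
      rw [Real.log_mul (by norm_num) (by positivity), Real.log_pow]
      rw [Real.log_div (by norm_num) hε.ne', Real.log_div one_ne_zero hθ0.ne', Real.log_one] at h1
      linarith
    exact (Real.log_le_log_iff (by positivity) hε).1 h2
  · have h1 : Real.log (4 / ε) ≤ 3 * Real.log (1 / ε) := by rw [hlog4]; linarith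
    have h0 : 0 ≤ Real.log (4 / ε) / Real.log (1 / θ) := by
      rw [hlog4]
      have : 0 ≤ 2 * Real.log 2 + Real.log (1 / ε) := by linarith
      positivity
    have h2 : Real.log (4 / ε) / Real.log (1 / θ) ≤ 3 / Real.log (1 / θ) * Real.log (1 / ε) := by
      rw [div_mul_eq_mul_div]
      gcongr
    have h3 := (Nat.ceil_lt_add_one h0).le
    linarith

/-- Correctness and running time of `descent`. -/
theorem descent_exec (O : Coeffs n → Gaps n) {η κ θ : ℚ} (hθ0 : (0 : ℝ) < θ) (hθ1 : (θ : ℝ) < 1)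
    {y : Gaps n} {guess z : Coeffs n} {ρ ε : ℝ} (hρ0 : 0 ≤ ρ) (hρθ : ρ ≤ θ) (hε : 0 < ε)
    (hε2 : ε ≤ 1 / 2)
    (hstep : ∀ μ : Coeffs n, ‖μ - z‖ ≤ 2 →
      ‖(μ - (η : ℝ) • fdGrad O y (κ * ε) μ) - z‖ ≤ ρ * ‖μ - z‖ + (1 - ρ) * (ε / 4))
    (hguess : ‖guess - z‖ ≤ 3 / 2) :
    ∃ (σ : Store n) (q t : ℕ), Exec O (descent n η κ θ) (Store.init y guess ε) σ q t ∧
      ‖σ.output - z‖ ≤ ε ∧ (q : ℝ) ≤ costFactor n θ * Real.log (1 / ε) ∧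
      (t : ℝ) ≤ costFactor n θ * Real.log (1 / ε) := by
  obtain ⟨hlog, m, hm, hmle⟩ := exists_iteration_count hθ0 hθ1 hε hε2
  set σ₀ := Store.init y guess ε with hσ₀
  -- The error bound is `3/8` of the threshold plus the bias `ε/4`, the fixed point of `x ↦ ρ x + (1
  -- - ρ) ε/4`. At threshold 4 it reads `3/2 + ε/4`, which stays below 2 as `hstep` requires; at
  -- exit it is at most `5ε/8`.
  set I : Store n → Prop := fun σ => (∀ e, σ (.est e) = y e) ∧ σ .tol = ε ∧ σ (.tmp 1) = θ ∧
    σ (.tmp 2) = κ * ε ∧ σ (.tmp 3) = η / (κ * ε) ∧ σ (.tmp 4) = 0 ∧ 0 < σ (.tmp 0) ∧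
    σ (.tmp 0) ≤ 4 ∧ ‖σ.output - z‖ ≤ 3 / 8 * σ (.tmp 0) + ε / 4 with hI
  have hbody : ∀ σ, I σ → σ .tol < σ (.tmp 0) → ∃ σ', Exec O (descentStep n) σ σ' (stepQueries n)
      (stepTime n) ∧ I σ' ∧ σ' .tol = σ .tol ∧ σ' (.tmp 0) = σ (.tmp 0) * θ := by
    rintro σ ⟨i1, i2, i3, i4, i5, i6, i7, i8, i9⟩ -
    obtain ⟨σ', j1, j2, j3, j4, j5, j6⟩ := descentStep_exec O σ i6 i4 i5 i1
    rw [i3] at j6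
    refine ⟨σ', j1, ⟨fun e => (j3 e).trans (i1 e), j4.trans i2, (j5 1 (by simp) (by simp)).trans i3,
      (j5 2 (by simp) (by simp)).trans i4, (j5 3 (by simp) (by simp)).trans i5,
      (j5 4 (by simp) (by simp)).trans i6, ?_, ?_, ?_⟩, j4, j6⟩
    · rw [j6]; positivity
    · rw [j6]
      nlinarith
    · rw [j2, j6]
      have h1 := hstep σ.output (by linarith)
      have h2 := mul_le_mul_of_nonneg_left i9 hρ0
      have h3 := mul_le_mul_of_nonneg_right hρθ i7.le
      linarith
  obtain ⟨σ₁, h1, h2⟩ : ∃ σ₁ : Store n, (∀ {σ q t},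
      Exec O (.while .tol (.tmp 0) (descentStep n)) σ₁ σ q t →
        Exec O (descent n η κ θ) σ₀ σ q (6 + t)) ∧ I σ₁ ∧ σ₁ (.tmp 0) = 4 := by
    refine ⟨_, fun h => Exec.of_eq (.seq (.const _ _ _) (.seq (.const _ _ _) (.seq (.const _ _ _)
      (.seq (.arith _ _ _ _ _) (.seq (.const _ _ _) (.seq (.arith _ _ _ _ _) h))))))
      (by ring) (by ring), ⟨?_, ?_, ?_, ?_, ?_, ?_, ?_, ?_, ?_⟩, ?_⟩
    · intro e
      simp [hσ₀, Store.init]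
    · simp [hσ₀, Store.init]
    · simp
    · simp [hσ₀, Store.init, Op.eval]
    · simp [hσ₀, Store.init, Op.eval]
    · simp [hσ₀, Store.init]
    · simp
    · simp
    · have : (WithLp.toLp 2 fun a => σ₀ (.cur a) : Coeffs n) = guess := by
        ext a
        simp [hσ₀, Store.init]
      simp [Store.output, this]
      linarith
    · simp
  obtain ⟨σ, q, t, h3, ⟨-, k2, -, -, -, -, -, -, k9⟩, h5, h6, h7, h8⟩ := while_run hbody m σ₁ h2.1
    (by rw [h2.2, h2.1.2.1]; exact hm)
  refine ⟨σ, q, 6 + t, h1 h3, by linarith, ?_, ?_⟩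
  · have h9 : (q : ℝ) ≤ m * stepQueries n := by exact_mod_cast h7
    have h10 : (m : ℝ) * stepQueries n ≤ m * (stepQueries n + stepTime n + 1) := by
      gcongr
      have : (0 : ℝ) ≤ stepTime n := by positivity
      linarith
    have h11 := mul_le_mul_of_nonneg_right hmle
      (show (0 : ℝ) ≤ stepQueries n + stepTime n + 1 by positivity)
    unfold costFactor
    linarith
  · have h9 : (t : ℝ) ≤ m * (stepTime n + 1) + 1 := by exact_mod_cast h8
    have h10 : (m : ℝ) * (stepTime n + 1) ≤ m * (stepQueries n + stepTime n + 1) := by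
      gcongr
      have : (0 : ℝ) ≤ stepQueries n := by positivity
      linarith
    have h11 := mul_le_mul_of_nonneg_right hmle
      (show (0 : ℝ) ≤ stepQueries n + stepTime n + 1 by positivity)
    -- Six initial steps and the last guard test make 7, absorbed in `14 * log (1/ε)`.
    push_cast
    unfold costFactor
    linarith

end Program

end HamLearn
end

noncomputable section
namespace HamLearn

/-! ### Strong control fields -/

open Metric
open scoped Topology

theorem gapVec_smooth_near_zero (n : ℕ) : ∃ ρ > 0, ∃ K : ℝ, 0 ≤ K ∧
    ContDiffOn ℝ ∞ (gapVec (n := n) 1) (ball 0 ρ) ∧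
    ∀ x ∈ ball (0 : Coeffs n) ρ, ∀ x' ∈ ball (0 : Coeffs n) ρ,
      ‖fderiv ℝ (gapVec 1) x - fderiv ℝ (gapVec 1) x'‖ ≤ K * ‖x - x'‖ := by
  have h := gapVec_contDiffAt n
  -- Analyticity yields one neighbourhood for all orders of differentiability; `ContDiffAt ℝ ∞`
  -- would only give one for each finite order.
  obtain ⟨u, hu, hsmooth⟩ := h.contDiffOn (m := ω) le_rfl (by simp)
  obtain ⟨K, v, hv, hlip⟩ := (h.fderiv_right (m := 1) (by simp)).exists_lipschitzOnWith
  obtain ⟨ρ, hρ, hsub⟩ := Metric.mem_nhds_iff.1 (Filter.inter_mem hu hv)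
  refine ⟨ρ, hρ, K, K.2, (hsmooth.of_le le_top).mono fun x hx => (hsub hx).1, fun x hx x' hx' => ?_⟩
  simpa [dist_eq_norm] using hlip.dist_le_mul x (hsub hx).2 x' (hsub hx').2

/-- For strong control fields the gap vector is nearly linear, uniformly in the Hamiltonian. -/
theorem exists_nearlyLinear (n : ℕ) : ∃ c M : ℝ, 0 < c ∧ 0 ≤ M ∧ ∃ ν₀ > 0, ∃ δ : ℝ,
    ∀ ν ≥ ν₀, ∀ lam : Coeffs n, (∀ a, -1 ≤ lam a ∧ lam a ≤ 1) →
      NearlyLinear (gapVec ν) (gapVecDeriv n) c M δ lam := by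
  obtain ⟨κ, hκ, hanti⟩ := (gapVecDeriv n : Coeffs n →ₗ[ℝ] Gaps n).exists_antilipschitzWith
    (LinearMap.ker_eq_bot.2 (gapVecDeriv_injective n))
  obtain ⟨ρ, hρ, K, hK, hsmooth, hlip⟩ := gapVec_smooth_near_zero n
  have hκ' : (0 : ℝ) < κ := hκ
  set c : ℝ := (κ : ℝ)⁻¹ with hc_def
  have hc : 0 < c := inv_pos.2 hκ'
  set M : ℝ := ‖gapVecDeriv n‖ with hM_def
  have hM : 0 ≤ M := norm_nonneg _
  have hR : 0 < 2 * M + 1 + residualBound M := by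
    unfold residualBound
    positivity
  set δ : ℝ := min 1 (c ^ 2 / 2 / (2 * M + 1 + residualBound M)) with hδ_def
  have hδ : 0 < δ := lt_min one_pos (by positivity)
  set R : ℝ := Fintype.card (Label n) * 1 + 4 with hR_def
  have hR1 : 1 ≤ R := by
    have : (0 : ℝ) ≤ Fintype.card (Label n) * 1 := by positivity
    linarith
  -- `R` bounds the norm on the ball of radius 4 around any admissible `lam`. The three summands
  -- ensure that `ν` is positive, that `ν⁻¹ • μ` stays in the ball of radius `ρ`, and that the
  -- derivative moves by at most `δ`.
  refine ⟨c, M, hc, hM, 1 + R / ρ + K * R / δ, by positivity, δ, fun ν hν lam hlam => ?_⟩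
  have h1 : 0 ≤ R / ρ := by positivity
  have h2 : 0 ≤ K * R / δ := by positivity
  have hν0 : 0 < ν := by linarith
  have hνρ : ν⁻¹ * R < ρ := by
    rw [inv_mul_lt_iff₀ hν0, ← div_lt_iff₀ hρ]
    linarith
  have hνδ : K * (ν⁻¹ * R) ≤ δ := by
    have h3 : K * R / δ ≤ ν := by linarith
    rw [div_le_iff₀ hδ] at h3
    rw [mul_left_comm, inv_mul_le_iff₀ hν0]
    exact h3
  have hνδ' : K * ν⁻¹ ≤ δ := by
    refine le_trans ?_ hνδ
    rw [← mul_assoc]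
    exact le_mul_of_one_le_right (by positivity) hR1
  have hball : ∀ μ ∈ ball lam 4, ‖ν⁻¹ • μ‖ < ν⁻¹ * R := by
    intro μ hμ
    have h3 : ‖lam‖ ≤ Fintype.card (Label n) * 1 :=
      euclidean_norm_le_card_mul fun a => abs_le.2 (hlam a)
    have h4 : ‖μ‖ < R := by
      have := norm_le_norm_add_norm_sub lam μ
      rw [mem_ball_iff_norm'] at hμ
      linarith
    rw [norm_smul, norm_inv, Real.norm_of_nonneg hν0.le]
    gcongr
  have hmem : ∀ μ ∈ ball lam 4, ν⁻¹ • μ ∈ ball (0 : Coeffs n) ρ := fun μ hμ =>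
    mem_ball_zero_iff.2 ((hball μ hμ).trans hνρ)
  have hscale : gapVec (n := n) ν = fun μ => ν • gapVec 1 (ν⁻¹ • μ) := funext (gapVec_scale hν0)
  -- The outer `ν` and the inner `ν⁻¹` cancel, so the limit `A` carries no scale, while the
  -- Lipschitz constant of the derivative gains a factor `ν⁻¹`.
  have hfd : ∀ μ ∈ ball lam 4, fderiv ℝ (gapVec ν) μ = fderiv ℝ (gapVec 1) (ν⁻¹ • μ) := by
    intro μ hμ
    have h3 : HasFDerivAt (gapVec 1) (fderiv ℝ (gapVec 1) (ν⁻¹ • μ)) (ν⁻¹ • μ) :=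
      ((hsmooth.contDiffAt (isOpen_ball.mem_nhds (hmem μ hμ))).differentiableAt
        (by simp)).hasFDerivAt
    have h4 := (h3.comp μ ((hasFDerivAt_id μ).const_smul ν⁻¹)).const_smul ν
    rw [hscale]
    refine (h4.congr_fderiv ?_).fderiv
    ext v : 1
    simp [smul_smul, mul_inv_cancel₀ hν0.ne']
  refine ⟨hc, hM, hδ.le, min_le_left _ _, ?_, le_rfl, ?_, ?_, ?_, ?_⟩
  · intro x
    have := hanti.le_mul_dist x 0
    simp only [dist_eq_norm, sub_zero, map_zero] at this
    rw [hc_def, inv_mul_le_iff₀ hκ']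
    exact this
  · rw [← le_div_iff₀ hR]
    exact min_le_right _ _
  · rw [hscale]
    exact (hsmooth.comp (contDiff_const_smul ν⁻¹).contDiffOn hmem).const_smul ν
  · intro μ hμ
    rw [hfd μ hμ, ← (gapVec_hasFDerivAt n).fderiv]
    refine (hlip _ (hmem μ hμ) 0 (mem_ball_self hρ)).trans (le_trans ?_ hνδ)
    rw [sub_zero]
    exact mul_le_mul_of_nonneg_left (hball μ hμ).le hK
  · intro μ hμ μ' hμ'
    rw [hfd μ hμ, hfd μ' hμ']
    refine (hlip _ (hmem μ hμ) _ (hmem μ' hμ')).trans ?_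
    rw [← smul_sub, norm_smul, norm_inv, Real.norm_of_nonneg hν0.le, ← mul_assoc]
    gcongr

end HamLearn
end

/-! ### Choice of constants and assembly -/

open HamLearn NearlyLinear in
theorem theoremS2 (n : ℕ) :
    ∃ ν₀ r rl C K : ℝ, 0 < ν₀ ∧ 0 < r ∧ 0 < rl ∧
    ∃ P : HamLearn.Prog n,
    ∀ ν : ℝ, ν₀ ≤ ν → ∀ lam : HamLearn.Coeffs n, (∀ a, -1 ≤ lam a ∧ lam a ≤ 1) →
    ∃ g : HamLearn.Gaps n → HamLearn.Coeffs n,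
      ContDiffOn ℝ ∞ g (Metric.ball (HamLearn.gapVec ν lam) r) ∧
      ∀ Ehat ∈ Metric.ball (HamLearn.gapVec ν lam) r,
        -- stability
        ‖g Ehat - lam‖ ≤ C * ‖Ehat - HamLearn.gapVec ν lam‖ ∧
        -- `g Ehat` is the solution near `lam` of the least-squares problem
        g Ehat ∈ Metric.ball lam rl ∧
        (∀ μ ∈ Metric.ball lam rl, HasGradientAt (HamLearn.loss ν Ehat) 0 μ ↔ μ = g Ehat) ∧
        (∀ μ ∈ Metric.ball lam rl, μ ≠ g Ehat →
          HamLearn.loss ν Ehat (g Ehat) < HamLearn.loss ν Ehat μ) ∧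
        -- computation of `g Ehat` with oracle access to `E(·, ν)`
        ∀ guess ∈ Metric.ball lam rl, ∀ ε₁ : ℝ, 0 < ε₁ → ε₁ ≤ 1 / 2 →
          ∃ (σ : HamLearn.Store n) (q t : ℕ),
            HamLearn.Exec (HamLearn.gapVec ν) P (HamLearn.Store.init Ehat guess ε₁) σ q t ∧
            ‖σ.output - g Ehat‖ ≤ ε₁ ∧
            (q : ℝ) ≤ K * Real.log (1 / ε₁) ∧ (t : ℝ) ≤ K * Real.log (1 / ε₁) := by
  obtain ⟨c, M, hc, hM, ν₀, hν₀, δ, hnear⟩ := exists_nearlyLinear n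
  have hres : 0 < residualBound M := by unfold residualBound; positivity
  have hgl : 0 < gradLip M := by unfold gradLip; positivity
  obtain ⟨η, hη0, hη1⟩ := exists_rat_btwn (lt_min (a := (0 : ℝ))
    (show 0 < c ^ 2 / 2 / gradLip M ^ 2 by positivity) (show 0 < 1 / (c ^ 2 / 2) by positivity))
  have hη : Admissible c M η := by
    refine ⟨hη0, ?_, ?_⟩
    · rw [← le_div_iff₀ (by positivity)]
      exact hη1.le.trans (min_le_left _ _)
    · rw [← le_div_iff₀ (by positivity)]
      exact hη1.le.trans (min_le_right _ _)
  set ρ := rate c η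
  have hρ0 : 0 < ρ := rate_pos hη
  have hρ1 : ρ < 1 := by
    have : 0 < (η : ℝ) * (c ^ 2 / 2) / 2 := by positivity
    simp only [ρ, rate]
    linarith
  -- Program constants must be rational, so the real rate `ρ` is replaced by a rational upper bound.
  obtain ⟨θ, hθ0, hθ1⟩ := exists_rat_btwn hρ1
  -- The extra 1 keeps the denominator below positive when `n = 0` and there are no labels.
  set N : ℝ := Fintype.card (Label n) + 1 with hN
  have hNpos : 0 < N := by positivity
  -- The first bound keeps the difference step at most 1; the second makes the finite-difference
  -- error per step at most `(1 - ρ) ε₁ / 4`.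
  obtain ⟨κ, hκ0, hκ1⟩ := exists_rat_btwn (lt_min (a := (0 : ℝ)) one_pos
    (show 0 < (1 - ρ) / 4 / (η * (N * residualBound M)) by
      have : 0 < 1 - ρ := by linarith
      positivity))
  have hκ2 : (κ : ℝ) ≤ 1 := hκ1.le.trans (min_le_left _ _)
  have hκ3 : (κ : ℝ) * (η * (N * residualBound M)) ≤ (1 - ρ) / 4 := by
    rw [← le_div_iff₀ (by positivity)]
    exact hκ1.le.trans (min_le_right _ _)
  set r := dataRadius c M with hr
  have hr0 : 0 < r := lt_min one_pos (by positivity)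
  refine ⟨ν₀, r, 1, (M + 1) / (c ^ 2 / 2), costFactor n θ, hν₀, hr0, one_pos,
    descent n η κ θ, fun ν hν lam hlam => ?_⟩
  have hF := hnear ν hν lam hlam
  have hex : ∀ y : Gaps n, ∃ μ : Coeffs n, y ∈ Metric.ball (gapVec ν lam) r →
      μ ∈ Metric.closedBall lam (1 / 2) ∧ lsGrad (gapVec ν) y μ = 0 := by
    intro y
    by_cases hy : y ∈ Metric.ball (gapVec ν lam) r
    · obtain ⟨μ, h1, h2⟩ := hF.exists_critical_point hη (mem_ball_iff_norm.1 hy)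
      exact ⟨μ, fun _ => ⟨h1, h2⟩⟩
    -- Outside the data ball the value of `g` is irrelevant.
    · exact ⟨lam, fun h => absurd h hy⟩
  choose g hg using hex
  have hsub4 : Metric.closedBall lam (1 / 2) ⊆ Metric.ball lam 4 :=
    Metric.closedBall_subset_ball (by norm_num)
  have hsub1 : Metric.ball lam 1 ⊆ Metric.ball lam 4 := Metric.ball_subset_ball (by norm_num)
  have hlt : ∀ y ∈ Metric.ball (gapVec ν lam) r, ‖y - gapVec ν lam‖ < 1 := fun y hy =>
    (mem_ball_iff_norm.1 hy).trans_le (min_le_left _ _)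
  have hg4 : ∀ y ∈ Metric.ball (gapVec ν lam) r, g y ∈ Metric.ball lam 4 := fun y hy =>
    hsub4 (hg y hy).1
  refine ⟨g, ?_, ?_⟩
  · intro y hy
    have hnhds : ∀ᶠ y' in nhds y, y' ∈ Metric.ball (gapVec ν lam) r :=
      Metric.isOpen_ball.mem_nhds hy
    refine (hF.contDiffAt_critical_point hη (hlt y hy) ?_ (hg4 y hy) ?_).contDiffWithinAt
    · obtain ⟨r', hr', hball⟩ := Metric.eventually_nhds_iff.1 hnhds
      refine continuousAt_of_locally_lipschitz hr' ((M + 1) / (c ^ 2 / 2)) fun y' hd => ?_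
      have hy' := hball hd
      rw [dist_eq_norm, dist_eq_norm]
      exact hF.norm_critical_sub_le (hlt y' hy').le (hg4 y' hy') (hg4 y hy) (hg y' hy').2
        (hg y hy).2
    · filter_upwards [hnhds] with y' hy'
      exact (hg y' hy').2
  · intro y hy
    have hy1 := (hlt y hy).le
    obtain ⟨hgm, hgz⟩ := hg y hy
    have hself := lsGrad_self (gapVec ν) lam
    refine ⟨hF.norm_critical_sub_le hy1 (hg4 y hy) (Metric.mem_ball_self (by norm_num)) hgz hself,
      Metric.closedBall_subset_ball (by norm_num) hgm, fun μ hμ => ?_, fun μ hμ hne => ?_, ?_⟩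
    · refine (hF.hasGradientAt_loss_zero_iff (y := y) (hsub1 hμ)).trans ⟨fun h => ?_, fun h => ?_⟩
      · exact hF.eq_of_lsGrad_eq_zero hy1 (hsub1 hμ) (hg4 y hy) h hgz
      · rw [h, hgz]
    · exact hF.loss_lt_loss hy1 (hg4 y hy) (hsub1 hμ) hgz hne
    · intro guess hguess ε hε hε2
      rw [mem_closedBall_iff_norm] at hgm
      refine descent_exec (gapVec ν) (hρ0.trans hθ0) hθ1 hρ0.le hθ0.le hε hε2 (fun μ hμ => ?_) ?_
      · have h0 : 0 < (κ : ℝ) * ε := by positivity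
        have h1 : (κ : ℝ) * ε ≤ 1 := by nlinarith
        -- Iterates stay within 2 of `g y`, which is within `1/2` of `lam`.
        have hμ3 : μ ∈ Metric.ball lam 3 := by
          rw [mem_ball_iff_norm]
          have := norm_sub_le_norm_sub_add_norm_sub μ (g y) lam
          linarith
        refine (hF.norm_step_sub_le hη hy1 h0 h1 hμ3 (hg4 y hy) hgz).trans ?_
        refine add_le_add_right ?_ _
        calc (η : ℝ) * (Fintype.card (Label n) * (residualBound M * (κ * ε)))
            ≤ η * (N * (residualBound M * (κ * ε))) := by
              gcongr
              linarith
          _ = κ * (η * (N * residualBound M)) * ε := by ring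
          _ ≤ (1 - ρ) / 4 * ε := by gcongr
          _ = (1 - ρ) * (ε / 4) := by ring
      · rw [mem_ball_iff_norm] at hguess
        have := norm_sub_le_norm_sub_add_norm_sub guess lam (g y)
        rw [norm_sub_rev lam] at this
        linarith
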